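/- Let $p\in\mathbb{C}$, $p\neq 0$, and let $\mathcal{S}(p)=\mathcal{S}(p)_{\bar 0}\oplus\mathcal{S}(p)_{\bar 1}$ be the Lie conformal superalgebra which is the free $\mathbb{C}[\partial]$-module with basis $\{L_i,W_i,G_i\mid i\ge 0\}$, with $L_i,W_i$ even and $G_i$ odd, and with the $\lambda$-brackets $$[L_i\,{}_\lambda\,L_j]=\big((i+p)\partial+(i+j+2p)\lambda\big)L_{i+j},\qquad [L_i\,{}_\lambda\,W_j]=\big((i+p)\partial+(i+j+p)\lambda\big)W_{i+j},$$ $$[L_i\,{}_\lambda\,G_j]=\big((i+p)\partial+(i+j+2p)\lambda\big)G_{i+j},\qquad [W_i\,{}_\lambda\,G_j]=G_{i+j},\qquad [W_i\,{}_\lambda\,W_j]=[G_i\,{}_\lambda\,G_j]=0$$ for $i,j\ge 0$, the remaining ones being given by super skew-symmetry. For $n\ge 0$ let $\mathcal{S}(p)_{\langle n\rangle}=\bigoplus_{i\ge n}\big(\mathbb{C}[\partial]L_i\oplus\mathbb{C}[\partial]W_i\oplus\mathbb{C}[\partial]G_i\big)$, which is an ideal of $\mathcal{S}(p)$, and let $\mathcal{S}(p)_{[n]}=\mathcal{S}(p)/\mathcal{S}(p)_{\langle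 n+1\rangle}$ be the quotient Lie conformal superalgebra. Let $V=V_{\bar 0}\oplus V_{\bar 1}$ be a conformal $\mathcal{S}(p)$-module that is finite (that is, finitely generated over $\mathbb{C}[\partial]$) and non-trivial (that is, its $\lambda$-action is not identically zero). Then there is an $N\ge 0$ such that $$L_i\,{}_\lambda\,v=W_i\,{}_\lambda\,v=G_i\,{}_\lambda\,v=0\qquad\text{for all } i\ge N \text{ and all } v\in V.$$ Hence, for all sufficiently large $n$, the Lie conformal superalgebra $\mathcal{S}(p)_{[n]}$ is finite (finitely generated over $\mathbb{C}[\partial]$) and $V$, with the same $\mathbb{Z}/2$-grading, is a conformal module over $\mathcal{S}(p)_{[n]}$ whose $\lambda$-action satisfies $\bar a\,{}_\lambda\,v=a\,{}_\lambda\,v$ for all $a\in\mathcal{S}(p)$ and $v\in V$, where $\bar a$ is the class of $a$ in $\mathcal{S}(p)_{[n]}$. -/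

import Mathlib

open Polynomial

noncomputable section

/-! Conventions.  A `ℂ[∂]`-module is a module over `ℂ[X]`, the indeterminate `X` acting as `∂`.
For a `ℂ[∂]`-module `U`, the space `U[λ] = ℂ[λ] ⊗ U` is `PolynomialModule ℂ[X] U`; it is a module
over `ℂ[X][X] = ℂ[∂][λ]`, in which `C X` is `∂` and `X` is `λ`. -/

/-- The space `U[λ]` of polynomials in `λ` with coefficients in the `ℂ[∂]`-module `U`. -/
abbrev LambdaPoly (U : Type*) [AddCommGroup U] [Module ℂ[X] U] : Type _ :=
  PolynomialModule ℂ[X] U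

/-- The value of a polynomial `P ∈ U[λ]` at the complex number `λ = l`. -/
def LambdaPoly.evalAt {U : Type*} [AddCommGroup U] [Module ℂ[X] U] (l : ℂ) :
    LambdaPoly U →ₗ[ℂ[X]] U :=
  PolynomialModule.eval (C l)

/-- The sign `(-1)^{αβ}` for parities `α`, `β`. -/
def paritySign (α β : ZMod 2) : ℂ := (-1) ^ (α.val * β.val)

/-- The structure of a Lie conformal superalgebra on a `ℂ[∂]`-module `S`: a `ℤ/2`-grading by
`ℂ[∂]`-submodules and a `λ`-bracket `S ⊗ S → S[λ]` that respects it, is sesquilinear,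
super skew-symmetric and satisfies the super Jacobi identity.  The Jacobi identity, an identity of
polynomials in `λ` and `μ`, is stated for all complex values `l`, `m` of `λ`, `μ`. -/
structure LieConformalSuperalgebra (S : Type*) [AddCommGroup S] [Module ℂ S] [Module ℂ[X] S]
    [IsScalarTower ℂ ℂ[X] S] where
  /-- the even part `part 0` and the odd part `part 1` -/
  part : ZMod 2 → Submodule ℂ[X] S
  isCompl_part : IsCompl (part 0) (part 1)
  /-- the `λ`-bracket -/
  bracket : S →ₗ[ℂ] S →ₗ[ℂ] LambdaPoly S
  bracket_mem : ∀ (α β : ZMod 2) (a b : S), a ∈ part α → b ∈ part β →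
    ∀ n, (bracket a b).coeff n ∈ part (α + β)
  /-- `[∂a_λ b] = -λ [a_λ b]` -/
  bracket_d_left : ∀ a b : S, bracket ((X : ℂ[X]) • a) b = -((X : ℂ[X][X]) • bracket a b)
  /-- `[a_λ ∂b] = (∂ + λ) [a_λ b]` -/
  bracket_d_right : ∀ a b : S, bracket a ((X : ℂ[X]) • b) = (C X + X : ℂ[X][X]) • bracket a b
  /-- `[a_λ b] = -(-1)^{|a||b|} [b_{-λ-∂} a]` -/
  skew : ∀ (α β : ZMod 2) (a b : S), a ∈ part α → b ∈ part β →
    bracket a b = -(paritySign α β • PolynomialModule.comp (-X - C X : ℂ[X][X]) (bracket b a))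
  /-- `[a_λ [b_μ c]] = [[a_λ b]_{λ+μ} c] + (-1)^{|a||b|} [b_μ [a_λ c]]` -/
  jacobi : ∀ (α β : ZMod 2) (a b c : S), a ∈ part α → b ∈ part β → ∀ l m : ℂ,
    LambdaPoly.evalAt l (bracket a (LambdaPoly.evalAt m (bracket b c))) =
      LambdaPoly.evalAt (l + m) (bracket (LambdaPoly.evalAt l (bracket a b)) c) +
        paritySign α β • LambdaPoly.evalAt m (bracket b (LambdaPoly.evalAt l (bracket a c)))

/-- The structure of a conformal module over the Lie conformal superalgebra `A` on a
`ℂ[∂]`-module `V`. -/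
structure ConformalModule {S : Type*} [AddCommGroup S] [Module ℂ S] [Module ℂ[X] S]
    [IsScalarTower ℂ ℂ[X] S] (A : LieConformalSuperalgebra S)
    (V : Type*) [AddCommGroup V] [Module ℂ V] [Module ℂ[X] V] [IsScalarTower ℂ ℂ[X] V] where
  /-- the even part `part 0` and the odd part `part 1` -/
  part : ZMod 2 → Submodule ℂ[X] V
  isCompl_part : IsCompl (part 0) (part 1)
  /-- the `λ`-action -/
  act : S →ₗ[ℂ] V →ₗ[ℂ] LambdaPoly V
  act_mem : ∀ (α β : ZMod 2) (a : S) (v : V), a ∈ A.part α → v ∈ part β →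
    ∀ n, (act a v).coeff n ∈ part (α + β)
  /-- `(∂a)_λ v = -λ a_λ v` -/
  act_d_left : ∀ (a : S) (v : V), act ((X : ℂ[X]) • a) v = -((X : ℂ[X][X]) • act a v)
  /-- `a_λ (∂v) = (∂ + λ) a_λ v` -/
  act_d_right : ∀ (a : S) (v : V), act a ((X : ℂ[X]) • v) = (C X + X : ℂ[X][X]) • act a v
  /-- `a_λ (b_μ v) - (-1)^{|a||b|} b_μ (a_λ v) = [a_λ b]_{λ+μ} v` -/
  act_bracket : ∀ (α β : ZMod 2) (a b : S) (v : V), a ∈ A.part α → b ∈ A.part β → ∀ l m : ℂ,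
    LambdaPoly.evalAt l (act a (LambdaPoly.evalAt m (act b v))) -
        paritySign α β • LambdaPoly.evalAt m (act b (LambdaPoly.evalAt l (act a v))) =
      LambdaPoly.evalAt (l + m) (act (LambdaPoly.evalAt l (A.bracket a b)) v)

/-- A conformal module is non-trivial if its `λ`-action is not identically zero. -/
def ConformalModule.Nontrivial {S : Type*} [AddCommGroup S] [Module ℂ S] [Module ℂ[X] S]
    [IsScalarTower ℂ ℂ[X] S] {A : LieConformalSuperalgebra S}
    {V : Type*} [AddCommGroup V] [Module ℂ V] [Module ℂ[X] V] [IsScalarTower ℂ ℂ[X] V]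
    (M : ConformalModule A V) : Prop :=
  ∃ (a : S) (v : V), M.act a v ≠ 0

/-! ### Ideals and quotients -/

section Projection

variable {S : Type*} [AddCommGroup S] [Module ℂ[X] S]

/-- The projection `S[λ] → (S/I)[λ]`. -/
def LambdaPoly.mk (I : Submodule ℂ[X] S) : LambdaPoly S →ₗ[ℂ[X]] LambdaPoly (S ⧸ I) :=
  PolynomialModule.map ℂ[X] I.mkQ

theorem LambdaPoly.coeff_mk (I : Submodule ℂ[X] S) (P : LambdaPoly S) (n : ℕ) :
    (LambdaPoly.mk I P).coeff n = I.mkQ (P.coeff n) := by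
  simp [LambdaPoly.mk, PolynomialModule.map]

theorem LambdaPoly.mk_eq_zero (I : Submodule ℂ[X] S) (P : LambdaPoly S)
    (h : ∀ n, P.coeff n ∈ I) : LambdaPoly.mk I P = 0 := by
  ext n
  rw [LambdaPoly.coeff_mk]
  simpa using h n

theorem LambdaPoly.mk_smul (I : Submodule ℂ[X] S) (q : ℂ[X][X]) (P : LambdaPoly S) :
    LambdaPoly.mk I (q • P) = q • LambdaPoly.mk I P := by
  have := PolynomialModule.map_smul (R' := ℂ[X]) I.mkQ q P
  simpa [LambdaPoly.mk] using this

theorem LambdaPoly.evalAt_mk (I : Submodule ℂ[X] S) (l : ℂ) (P : LambdaPoly S) :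
    LambdaPoly.evalAt l (LambdaPoly.mk I P) = I.mkQ (LambdaPoly.evalAt l P) :=
  PolynomialModule.eval_map (R' := ℂ[X]) I.mkQ P (C l)

theorem LambdaPoly.comp_mk (I : Submodule ℂ[X] S) (q : ℂ[X][X]) (P : LambdaPoly S) :
    PolynomialModule.comp q (LambdaPoly.mk I P) = LambdaPoly.mk I (PolynomialModule.comp q P) := by
  induction P using PolynomialModule.induction_linear with
  | zero => simp
  | add P Q hP hQ => simp only [map_add, hP, hQ]
  | single n m =>
    rw [PolynomialModule.comp_single, LambdaPoly.mk_smul]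
    simp only [LambdaPoly.mk, PolynomialModule.map_single, PolynomialModule.comp_single]

theorem LambdaPoly.mkQ_out (I : Submodule ℂ[X] S) (x : S ⧸ I) : I.mkQ (Quotient.out x) = x :=
  Quotient.out_eq x

end Projection

section Quotient

variable {S : Type*} [AddCommGroup S] [Module ℂ S] [Module ℂ[X] S] [IsScalarTower ℂ ℂ[X] S]

/-- A (graded, two-sided) ideal of a Lie conformal superalgebra. -/
structure LieConformalSuperalgebra.IsIdeal (A : LieConformalSuperalgebra S)
    (I : Submodule ℂ[X] S) : Prop where
  graded : I ≤ (I ⊓ A.part 0) ⊔ (I ⊓ A.part 1)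
  bracket_mem_right : ∀ (a : S), ∀ x ∈ I, ∀ n, (A.bracket a x).coeff n ∈ I
  bracket_mem_left : ∀ x ∈ I, ∀ (a : S), ∀ n, (A.bracket x a).coeff n ∈ I

theorem LieConformalSuperalgebra.IsIdeal.mk_bracket_congr {A : LieConformalSuperalgebra S}
    {I : Submodule ℂ[X] S} (h : A.IsIdeal I) {a a' b b' : S}
    (ha : I.mkQ a = I.mkQ a') (hb : I.mkQ b = I.mkQ b') :
    LambdaPoly.mk I (A.bracket a b) = LambdaPoly.mk I (A.bracket a' b') := by
  have ha' : a - a' ∈ I := by simpa [Submodule.Quotient.eq] using ha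
  have hb' : b - b' ∈ I := by simpa [Submodule.Quotient.eq] using hb
  have h1 := LambdaPoly.mk_eq_zero I _ (h.bracket_mem_left _ ha' b)
  have h2 := LambdaPoly.mk_eq_zero I _ (h.bracket_mem_right a' _ hb')
  simp only [map_sub, LinearMap.sub_apply, sub_eq_zero] at h1 h2
  rw [h1, h2]

/-- The bracket `[(a + I)_λ (b + I)] = [a_λ b] + I[λ]` on `S/I`. -/
def LieConformalSuperalgebra.IsIdeal.bracket {A : LieConformalSuperalgebra S}
    {I : Submodule ℂ[X] S} (h : A.IsIdeal I) :
    (S ⧸ I) →ₗ[ℂ] (S ⧸ I) →ₗ[ℂ] LambdaPoly (S ⧸ I) :=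
  LinearMap.mk₂ ℂ
    (fun x y => LambdaPoly.mk I (A.bracket (Quotient.out x) (Quotient.out y)))
    (fun x x' y => by
      rw [← map_add, ← LinearMap.add_apply, ← map_add]
      exact h.mk_bracket_congr (by simp only [map_add, LambdaPoly.mkQ_out]) rfl)
    (fun c x y => by
      rw [← LinearMap.map_smul_of_tower, ← LinearMap.smul_apply, ← map_smul]
      exact h.mk_bracket_congr
        (by simp only [LinearMap.map_smul_of_tower, LambdaPoly.mkQ_out]) rfl)
    (fun x y y' => by
      rw [← map_add, ← map_add]
      exact h.mk_bracket_congr rfl (by simp only [map_add, LambdaPoly.mkQ_out]))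
    (fun c x y => by
      rw [← LinearMap.map_smul_of_tower, ← map_smul]
      exact h.mk_bracket_congr rfl
        (by simp only [LinearMap.map_smul_of_tower, LambdaPoly.mkQ_out]))

theorem LieConformalSuperalgebra.IsIdeal.bracket_mk {A : LieConformalSuperalgebra S}
    {I : Submodule ℂ[X] S} (h : A.IsIdeal I) (a b : S) :
    h.bracket (I.mkQ a) (I.mkQ b) = LambdaPoly.mk I (A.bracket a b) :=
  h.mk_bracket_congr (LambdaPoly.mkQ_out I _) (LambdaPoly.mkQ_out I _)

/-- The quotient Lie conformal superalgebra `S/I`. -/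
def LieConformalSuperalgebra.quotient (A : LieConformalSuperalgebra S)
    (I : Submodule ℂ[X] S) (h : A.IsIdeal I) : LieConformalSuperalgebra (S ⧸ I) where
  part α := (A.part α).map I.mkQ
  isCompl_part := by
    constructor
    · rw [Submodule.disjoint_def]
      rintro _ ⟨a, ha, rfl⟩ ⟨b, hb, hab⟩
      have hI : b - a ∈ I := by simpa [Submodule.Quotient.eq] using hab
      obtain ⟨u, hu, w, hw, huw⟩ := Submodule.mem_sup.1 (h.graded hI)
      have h1 : u + a ∈ A.part 0 := Submodule.add_mem _ hu.2 ha
      have h2 : u + a ∈ A.part 1 := by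
        have : u + a = b - w := by rw [eq_sub_iff_add_eq, add_right_comm, huw]; abel
        rw [this]
        exact Submodule.sub_mem _ hb hw.2
      have h0 := Submodule.disjoint_def.1 A.isCompl_part.disjoint _ h1 h2
      have : a = -u := by rw [eq_neg_iff_add_eq_zero, add_comm]; exact h0
      rw [this]
      simpa using hu.1
    · rw [codisjoint_iff, ← Submodule.map_sup, A.isCompl_part.sup_eq_top, Submodule.map_top,
        Submodule.range_mkQ]
  bracket := h.bracket
  bracket_mem := by
    rintro α β _ _ ⟨a, ha, rfl⟩ ⟨b, hb, rfl⟩ n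
    rw [h.bracket_mk, LambdaPoly.coeff_mk]
    exact Submodule.mem_map_of_mem (A.bracket_mem α β a b ha hb n)
  bracket_d_left a b := by
    obtain ⟨a, rfl⟩ := I.mkQ_surjective a
    obtain ⟨b, rfl⟩ := I.mkQ_surjective b
    rw [← map_smul, h.bracket_mk, h.bracket_mk, A.bracket_d_left, map_neg, LambdaPoly.mk_smul]
  bracket_d_right a b := by
    obtain ⟨a, rfl⟩ := I.mkQ_surjective a
    obtain ⟨b, rfl⟩ := I.mkQ_surjective b
    rw [← map_smul, h.bracket_mk, h.bracket_mk, A.bracket_d_right, LambdaPoly.mk_smul]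
  skew := by
    rintro α β _ _ ⟨a, ha, rfl⟩ ⟨b, hb, rfl⟩
    rw [h.bracket_mk, h.bracket_mk, A.skew α β a b ha hb, LambdaPoly.comp_mk, map_neg,
      LinearMap.map_smul_of_tower]
  jacobi := by
    rintro α β _ _ c ⟨a, ha, rfl⟩ ⟨b, hb, rfl⟩ l m
    obtain ⟨c, rfl⟩ := I.mkQ_surjective c
    simp only [h.bracket_mk, LambdaPoly.evalAt_mk]
    rw [A.jacobi α β a b c ha hb, map_add, LinearMap.map_smul_of_tower]

end Quotient

/-! ### The Lie conformal superalgebra `𝒮(p)` -/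

namespace BlockS

/-- The free generators `L_i`, `W_i` (even) and `G_i` (odd), `i ∈ ℤ₊`. -/
inductive Gen : Type
  | L (i : ℕ) : Gen
  | W (i : ℕ) : Gen
  | G (i : ℕ) : Gen

namespace Gen

/-- the parity of a generator -/
def parity : Gen → ZMod 2
  | L _ => 0
  | W _ => 0
  | G _ => 1

/-- the index of a generator -/
def index : Gen → ℕ
  | L i => i
  | W i => i
  | G i => i

end Gen

/-- The underlying free `ℂ[∂]`-module of `𝒮(p)`, with basis `L_i`, `W_i`, `G_i`. -/
abbrev Carrier : Type := Gen →₀ ℂ[X]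

/-- A generator as an element of `𝒮(p)`. -/
def gen (x : Gen) : Carrier := Finsupp.single x 1

/-- the elements `L_i` -/
def L (i : ℕ) : Carrier := gen (Gen.L i)

/-- the elements `W_i` -/
def W (i : ℕ) : Carrier := gen (Gen.W i)

/-- the elements `G_i` -/
def G (i : ℕ) : Carrier := gen (Gen.G i)

/-- `(a ∂ + b λ) u` as an element of `𝒮(p)[λ]`. -/
def lin (a b : ℂ) (u : Carrier) : LambdaPoly Carrier :=
  (C (C a * X) + C (C b) * X : ℂ[X][X]) • PolynomialModule.single ℂ[X] 0 u

/-- The `λ`-brackets of the generators; those of `(W, L)`, `(G, L)`, `(G, W)` are the ones that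
skew-symmetry forces. -/
def genBracket (p : ℂ) : Gen → Gen → LambdaPoly Carrier
  | .L i, .L j => lin (i + p) (i + j + 2 * p) (L (i + j))
  | .L i, .W j => lin (i + p) (i + j + p) (W (i + j))
  | .L i, .G j => lin (i + p) (i + j + 2 * p) (G (i + j))
  | .W i, .L j => lin i (i + j + p) (W (i + j))
  | .W _, .W _ => 0
  | .W i, .G j => PolynomialModule.single ℂ[X] 0 (G (i + j))
  | .G i, .L j => lin (i + p) (i + j + 2 * p) (G (i + j))
  | .G i, .W j => -PolynomialModule.single ℂ[X] 0 (G (i + j))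
  | .G _, .G _ => 0

/-- The sesquilinear extension: `[f(∂)x _λ g(∂)y] = f(-λ) g(∂ + λ) [x _λ y]` for generators
`x`, `y`. -/
def bracket (p : ℂ) : Carrier →ₗ[ℂ] Carrier →ₗ[ℂ] LambdaPoly Carrier :=
  LinearMap.mk₂ ℂ
    (fun a b => a.sum fun x f => b.sum fun y g =>
      (aeval (-X : ℂ[X][X]) f * aeval (C X + X : ℂ[X][X]) g) • genBracket p x y)
    (fun a a' b => by
      refine Finsupp.sum_add_index' (by simp) fun x f f' => ?_
      simp only [map_add, add_mul, add_smul, Finsupp.sum_add])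
    (fun c a b => by
      rw [Finsupp.sum_smul_index' (by simp), Finsupp.smul_sum]
      refine Finsupp.sum_congr fun x _ => ?_
      rw [Finsupp.smul_sum]
      refine Finsupp.sum_congr fun y _ => ?_
      rw [map_smul, smul_mul_assoc, smul_assoc])
    (fun a b b' => by
      rw [← Finsupp.sum_add]
      refine Finsupp.sum_congr fun x _ => ?_
      refine Finsupp.sum_add_index' (by simp) fun y g g' => ?_
      simp only [map_add, mul_add, add_smul])
    (fun c a b => by
      rw [Finsupp.smul_sum]
      refine Finsupp.sum_congr fun x _ => ?_
      rw [Finsupp.sum_smul_index' (by simp), Finsupp.smul_sum]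
      refine Finsupp.sum_congr fun y _ => ?_
      rw [map_smul, mul_smul_comm, smul_assoc])

theorem bracket_single (p : ℂ) (x y : Gen) (f g : ℂ[X]) :
    bracket p (Finsupp.single x f) (Finsupp.single y g) =
      (aeval (-X : ℂ[X][X]) f * aeval (C X + X : ℂ[X][X]) g) • genBracket p x y := by
  simp [bracket]

theorem bracket_gen (p : ℂ) (x y : Gen) : bracket p (gen x) (gen y) = genBracket p x y := by
  simp [gen, bracket_single]

theorem bracket_smul_left (p : ℂ) (f : ℂ[X]) (a b : Carrier) :
    bracket p (f • a) b = aeval (-X : ℂ[X][X]) f • bracket p a b := by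
  simp only [bracket, LinearMap.mk₂_apply]
  rw [Finsupp.sum_smul_index' (by simp), Finsupp.smul_sum]
  refine Finsupp.sum_congr fun x _ => ?_
  rw [Finsupp.smul_sum]
  refine Finsupp.sum_congr fun y _ => ?_
  rw [smul_eq_mul, map_mul, mul_assoc, smul_smul]

theorem bracket_smul_right (p : ℂ) (f : ℂ[X]) (a b : Carrier) :
    bracket p a (f • b) = aeval (C X + X : ℂ[X][X]) f • bracket p a b := by
  simp only [bracket, LinearMap.mk₂_apply]
  rw [Finsupp.smul_sum]
  refine Finsupp.sum_congr fun x _ => ?_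
  rw [Finsupp.sum_smul_index' (by simp), Finsupp.smul_sum]
  refine Finsupp.sum_congr fun y _ => ?_
  rw [smul_eq_mul, map_mul, mul_left_comm, smul_smul]

theorem evalAt_smul (l : ℂ) (q : ℂ[X][X]) (P : LambdaPoly Carrier) :
    LambdaPoly.evalAt l (q • P) = q.eval (C l) • LambdaPoly.evalAt l P :=
  PolynomialModule.eval_smul q P (C l)

theorem eval_aeval_left (l : ℂ) (f : ℂ[X]) :
    (aeval (-X : ℂ[X][X]) f).eval (C l) = C (f.eval (-l)) := by
  induction f using Polynomial.induction_on' with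
  | add f g hf hg => simp only [map_add, eval_add, hf, hg]
  | monomial n c =>
    simp [aeval_monomial, IsScalarTower.algebraMap_apply ℂ ℂ[X] ℂ[X][X]]

theorem eval_aeval_right (l : ℂ) (f : ℂ[X]) :
    (aeval (C X + X : ℂ[X][X]) f).eval (C l) = f.comp (X + C l) := by
  induction f using Polynomial.induction_on' with
  | add f g hf hg => simp only [map_add, eval_add, hf, hg, add_comp]
  | monomial n c =>
    simp [aeval_monomial, IsScalarTower.algebraMap_apply ℂ ℂ[X] ℂ[X][X]]

theorem evalAt_bracket_smul_left (p l : ℂ) (f : ℂ[X]) (a b : Carrier) :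
    LambdaPoly.evalAt l (bracket p (f • a) b) =
      C (f.eval (-l)) • LambdaPoly.evalAt l (bracket p a b) := by
  rw [bracket_smul_left, evalAt_smul, eval_aeval_left]

theorem evalAt_bracket_smul_right (p l : ℂ) (f : ℂ[X]) (a b : Carrier) :
    LambdaPoly.evalAt l (bracket p a (f • b)) =
      f.comp (X + C l) • LambdaPoly.evalAt l (bracket p a b) := by
  rw [bracket_smul_right, evalAt_smul, eval_aeval_right]

theorem evalAt_lin (l a b : ℂ) (u : Carrier) :
    LambdaPoly.evalAt l (lin a b u) = (C a * X + C (b * l)) • u := by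
  rw [lin, evalAt_smul]
  simp [LambdaPoly.evalAt]

theorem evalAt_single (l : ℂ) (u : Carrier) :
    LambdaPoly.evalAt l (PolynomialModule.single ℂ[X] 0 u) = u := by
  simp [LambdaPoly.evalAt]

/-- The elements of parity `α`: the free `ℂ[∂]`-module on the generators of parity `α`. -/
def part (α : ZMod 2) : Submodule ℂ[X] Carrier :=
  Finsupp.supported ℂ[X] ℂ[X] {x | x.parity = α}

theorem part_induction {α : ZMod 2} {P : Carrier → Prop} {a : Carrier} (ha : a ∈ part α)
    (hgen : ∀ x : Gen, x.parity = α → P (gen x)) (hzero : P 0)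
    (hadd : ∀ a b, P a → P b → P (a + b)) (hsmul : ∀ (f : ℂ[X]) a, P a → P (f • a)) : P a := by
  rw [part, Finsupp.supported_eq_span_single] at ha
  induction ha using Submodule.span_induction with
  | mem _ h => obtain ⟨x, hx, rfl⟩ := h; exact hgen x hx
  | zero => exact hzero
  | add a b _ _ iha ihb => exact hadd a b iha ihb
  | smul f a _ ih => exact hsmul f a ih

theorem carrier_induction {P : Carrier → Prop} (a : Carrier)
    (hgen : ∀ x : Gen, P (gen x)) (hzero : P 0)
    (hadd : ∀ a b, P a → P b → P (a + b)) (hsmul : ∀ (f : ℂ[X]) a, P a → P (f • a)) : P a := by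
  induction a using Finsupp.induction_linear with
  | zero => exact hzero
  | add a b iha ihb => exact hadd a b iha ihb
  | single x f => simpa [gen] using hsmul f _ (hgen x)

theorem gen_mem_part (x : Gen) : gen x ∈ part x.parity :=
  Finsupp.single_mem_supported _ _ rfl

theorem isCompl_part : IsCompl (part 0) (part 1) := by
  constructor
  · refine Finsupp.disjoint_supported_supported ?_
    rw [Set.disjoint_left]
    intro x hx hx'
    have h0 : x.parity = 0 := hx
    have h1 : x.parity = 1 := hx'
    rw [h0] at h1
    exact absurd h1 (by decide)
  · refine Finsupp.codisjoint_supported_supported ?_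
    rw [codisjoint_iff]
    ext x
    cases x <;> simp [Gen.parity]

theorem coeff_smul_mem (N : Submodule ℂ[X] Carrier) (q : ℂ[X][X]) (P : LambdaPoly Carrier)
    (h : ∀ n, P.coeff n ∈ N) (n : ℕ) : (q • P).coeff n ∈ N := by
  rw [PolynomialModule.smul_apply]
  exact Submodule.sum_mem _ fun x _ => Submodule.smul_mem _ _ (h _)

theorem coeff_single_mem (N : Submodule ℂ[X] Carrier) (u : Carrier) (h : u ∈ N) (n : ℕ) :
    (PolynomialModule.single ℂ[X] 0 u).coeff n ∈ N := by
  rw [PolynomialModule.coeff_single, Finsupp.single_apply]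
  split_ifs
  · exact h
  · exact N.zero_mem

theorem coeff_lin_mem (N : Submodule ℂ[X] Carrier) (a b : ℂ) (u : Carrier) (h : u ∈ N) (n : ℕ) :
    (lin a b u).coeff n ∈ N :=
  coeff_smul_mem N _ _ (coeff_single_mem N u h) n

theorem coeff_genBracket_mem (p : ℂ) (N : Submodule ℂ[X] Carrier) (x y : Gen)
    (h : ∀ z : Gen, z.index = x.index + y.index → z.parity = x.parity + y.parity → gen z ∈ N)
    (n : ℕ) : (genBracket p x y).coeff n ∈ N := by
  cases x <;> cases y <;> simp only [genBracket]
  case L.L => exact coeff_lin_mem N _ _ _ (h _ rfl (by simp [Gen.parity])) n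
  case L.W => exact coeff_lin_mem N _ _ _ (h _ rfl (by simp [Gen.parity])) n
  case L.G => exact coeff_lin_mem N _ _ _ (h _ rfl (by simp [Gen.parity])) n
  case W.L => exact coeff_lin_mem N _ _ _ (h _ rfl (by simp [Gen.parity])) n
  case W.W => exact N.zero_mem
  case W.G => exact coeff_single_mem N _ (h _ rfl (by simp [Gen.parity])) n
  case G.L => exact coeff_lin_mem N _ _ _ (h _ rfl (by simp [Gen.parity])) n
  case G.W =>
    rw [← neg_one_smul ℂ[X][X]]
    exact coeff_smul_mem N _ _ (coeff_single_mem N _ (h _ rfl (by simp [Gen.parity]))) n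
  case G.G => exact N.zero_mem

theorem bracket_coeff_mem (p : ℂ) (A B N : Set Gen)
    (h : ∀ x ∈ A, ∀ y ∈ B, ∀ z : Gen, z.index = x.index + y.index →
      z.parity = x.parity + y.parity → z ∈ N)
    (a b : Carrier) (ha : a ∈ Finsupp.supported ℂ[X] ℂ[X] A)
    (hb : b ∈ Finsupp.supported ℂ[X] ℂ[X] B) (n : ℕ) :
    (bracket p a b).coeff n ∈ Finsupp.supported ℂ[X] ℂ[X] N := by
  simp only [bracket, LinearMap.mk₂_apply, Finsupp.sum, PolynomialModule.coeff_sum,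
    Finsupp.finsetSum_apply]
  refine Submodule.sum_mem _ fun x hx => Submodule.sum_mem _ fun y hy => ?_
  refine coeff_smul_mem _ _ _ (fun m => coeff_genBracket_mem p _ x y ?_ m) n
  intro z hz hz'
  exact Finsupp.single_mem_supported _ _ (h x (ha hx) y (hb hy) z hz hz')

theorem bracket_skew (p : ℂ) (α β : ZMod 2) (a b : Carrier) (ha : a ∈ part α) (hb : b ∈ part β) :
    bracket p a b =
      -(paritySign α β • PolynomialModule.comp (-X - C X : ℂ[X][X]) (bracket p b a)) := by
  have hL : ∀ f : ℂ[X], (aeval (-X : ℂ[X][X]) f).comp (-X - C X) = aeval (C X + X : ℂ[X][X]) f := by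
    intro f
    induction f using Polynomial.induction_on' with
    | add f g hf hg => simp only [map_add, add_comp, hf, hg]
    | monomial n c =>
      simp [aeval_monomial, IsScalarTower.algebraMap_apply ℂ ℂ[X] ℂ[X][X], add_comm]
  have hR : ∀ f : ℂ[X], (aeval (C X + X : ℂ[X][X]) f).comp (-X - C X) = aeval (-X : ℂ[X][X]) f := by
    intro f
    induction f using Polynomial.induction_on' with
    | add f g hf hg => simp only [map_add, add_comp, hf, hg]
    | monomial n c =>
      simp [aeval_monomial, IsScalarTower.algebraMap_apply ℂ ℂ[X] ℂ[X][X]]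
  refine part_induction (P := fun a => bracket p a b = -(paritySign α β •
    PolynomialModule.comp (-X - C X : ℂ[X][X]) (bracket p b a)))
    ha (fun x hx => ?_) ?_ (fun a a' h h' => ?_) (fun f a h => ?_)
  · refine part_induction (P := fun b => bracket p (gen x) b = -(paritySign α β •
      PolynomialModule.comp (-X - C X : ℂ[X][X]) (bracket p b (gen x))))
      hb (fun y hy => ?_) ?_ (fun b b' h h' => ?_) (fun f b h => ?_)
    · subst hx hy
      rw [bracket_gen, bracket_gen]
      cases x <;> cases y <;>
        simp only [genBracket, Gen.parity, paritySign, lin, PolynomialModule.comp_smul,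
          PolynomialModule.comp_single, map_neg, map_zero, neg_zero, smul_zero, pow_zero, one_smul,
          ZMod.val_zero, mul_zero, zero_mul, neg_neg, ← neg_smul]
      case L.W | W.L | L.L | L.G | G.L =>
        rename_i i j
        rw [add_comm j i]
        congr 1
        simp only [add_comp, mul_comp, C_comp, X_comp, map_add, map_mul, map_natCast,
          natCast_comp, map_ofNat, ofNat_comp]
        ring
      case W.G | G.W => rw [Nat.add_comm]
    · simp
    · simp only [map_add, LinearMap.add_apply, smul_add, neg_add, ← h, ← h']
    · rw [bracket_smul_right, bracket_smul_left, PolynomialModule.comp_smul, hL, h, smul_neg,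
        smul_comm]
  · simp
  · simp only [map_add, LinearMap.add_apply, smul_add, neg_add, ← h, ← h']
  · rw [bracket_smul_right, bracket_smul_left, PolynomialModule.comp_smul, hR, h, smul_neg,
      smul_comm]

theorem evalAt_C_smul_left (p l c : ℂ) (a b : Carrier) :
    LambdaPoly.evalAt l (bracket p (C c • a) b) = C c • LambdaPoly.evalAt l (bracket p a b) := by
  rw [evalAt_bracket_smul_left, eval_C]

/-- The Jacobi identity for `a`, `b`, `c` with sign `s`, at `λ = l`, `μ = m`. -/
def JacobiAt (p s l m : ℂ) (a b c : Carrier) : Prop :=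
  LambdaPoly.evalAt l (bracket p a (LambdaPoly.evalAt m (bracket p b c))) =
    LambdaPoly.evalAt (l + m) (bracket p (LambdaPoly.evalAt l (bracket p a b)) c) +
      s • LambdaPoly.evalAt m (bracket p b (LambdaPoly.evalAt l (bracket p a c)))

theorem jacobiAt_smul_left (p s l m : ℂ) (f : ℂ[X]) (a b c : Carrier)
    (H : JacobiAt p s l m a b c) : JacobiAt p s l m (f • a) b c := by
  unfold JacobiAt at *
  simp only [evalAt_bracket_smul_left, evalAt_bracket_smul_right, H, smul_add, eval_C, C_comp]
  rw [smul_comm s]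

theorem jacobiAt_smul_mid (p s l m : ℂ) (f : ℂ[X]) (a b c : Carrier)
    (H : JacobiAt p s l m a b c) : JacobiAt p s l m a (f • b) c := by
  unfold JacobiAt at *
  have : (f.comp (X + C l)).eval (-(l + m)) = f.eval (-m) := by
    rw [eval_comp, eval_add, eval_X, eval_C]; ring_nf
  rw [evalAt_bracket_smul_left, evalAt_bracket_smul_right, evalAt_bracket_smul_right,
    evalAt_bracket_smul_left, evalAt_bracket_smul_left, this, C_comp, H, smul_add, smul_comm s]

theorem jacobiAt_smul_right (p s l m : ℂ) (f : ℂ[X]) (a b c : Carrier)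
    (H : JacobiAt p s l m a b c) : JacobiAt p s l m a b (f • c) := by
  unfold JacobiAt at *
  have h1 : (f.comp (X + C m)).comp (X + C l) = f.comp (X + C (l + m)) := by
    rw [comp_assoc, add_comp, X_comp, C_comp, C_add, add_assoc]
  have h2 : (f.comp (X + C l)).comp (X + C m) = f.comp (X + C (l + m)) := by
    rw [comp_assoc, add_comp, X_comp, C_comp, C_add, add_assoc, add_comm (C m)]
  simp only [evalAt_bracket_smul_right, h1, h2, H, smul_add]
  rw [smul_comm s]

theorem jacobiAt_gen (p l m : ℂ) (x y z : Gen) :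
    JacobiAt p (paritySign x.parity y.parity) l m (gen x) (gen y) (gen z) := by
  unfold JacobiAt
  cases x <;> cases y <;> cases z <;>
    simp only [bracket_gen, genBracket, evalAt_lin, evalAt_single, map_zero, map_neg,
      evalAt_bracket_smul_left, evalAt_bracket_smul_right, L, W, G,
      Gen.parity, paritySign, LinearMap.zero_apply, LinearMap.neg_apply]
  all_goals
    simp only [ZMod.val_zero, mul_zero, zero_mul, pow_zero, one_smul, smul_zero, add_zero,
      neg_zero, Nat.add_assoc, Nat.add_left_comm, Nat.cast_add, add_comp, mul_comp, C_comp, X_comp,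
      eval_add, eval_mul, eval_C, eval_X, map_add, map_mul, map_neg, map_ofNat,
      ofNat_comp, eval_ofNat]
  all_goals module

theorem bracket_jacobi (p : ℂ) (α β : ZMod 2) (a b c : Carrier)
    (ha : a ∈ part α) (hb : b ∈ part β) (l m : ℂ) : JacobiAt p (paritySign α β) l m a b c := by
  refine part_induction (P := fun a => JacobiAt p (paritySign α β) l m a b c) ha
    (fun x hx => ?_) ?_ (fun a a' h h' => ?_) (fun f a h => ?_)
  · refine part_induction (P := fun b => JacobiAt p (paritySign α β) l m (gen x) b c) hb
      (fun y hy => ?_) ?_ (fun b b' h h' => ?_) (fun f b h => ?_)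
    · refine carrier_induction
        (P := fun c => JacobiAt p (paritySign α β) l m (gen x) (gen y) c) c
        (fun z => ?_) ?_ (fun c c' h h' => ?_) (fun f c h => ?_)
      · subst hx hy
        exact jacobiAt_gen p l m x y z
      · simp [JacobiAt]
      · unfold JacobiAt at *
        simp only [map_add, h, h', smul_add]; abel
      · exact jacobiAt_smul_right p _ l m f _ _ _ h
    · simp [JacobiAt]
    · unfold JacobiAt at *
      simp only [map_add, LinearMap.add_apply, h, h', smul_add]; abel
    · exact jacobiAt_smul_mid p _ l m f _ _ _ h
  · simp [JacobiAt]
  · unfold JacobiAt at *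
    simp only [map_add, LinearMap.add_apply, h, h', smul_add]; abel
  · exact jacobiAt_smul_left p _ l m f _ _ _ h

/-- The Lie conformal superalgebra `𝒮(p)`. -/
def algebra (p : ℂ) : LieConformalSuperalgebra Carrier where
  part := part
  isCompl_part := isCompl_part
  bracket := bracket p
  bracket_mem α β a b ha hb n := by
    refine bracket_coeff_mem p _ _ _ ?_ a b ha hb n
    rintro x rfl y rfl z _ hz
    exact hz
  bracket_d_left a b := by rw [bracket_smul_left, aeval_X, neg_smul]
  bracket_d_right a b := by rw [bracket_smul_right, aeval_X]
  skew := bracket_skew p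
  jacobi α β a b c ha hb l m := bracket_jacobi p α β a b c ha hb l m

/-- `𝒮(p)_{⟨n⟩} = ⨁_{i ≥ n} (ℂ[∂]L_i ⊕ ℂ[∂]W_i ⊕ ℂ[∂]G_i)`. -/
def tail (n : ℕ) : Submodule ℂ[X] Carrier :=
  Finsupp.supported ℂ[X] ℂ[X] {x | n ≤ x.index}

theorem isIdeal_tail (p : ℂ) (n : ℕ) : (algebra p).IsIdeal (tail n) where
  graded := by
    change tail n ≤ (tail n ⊓ part 0) ⊔ (tail n ⊓ part 1)
    rw [tail, Finsupp.supported_eq_span_single, Submodule.span_le,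
      ← Finsupp.supported_eq_span_single]
    rintro _ ⟨x, hx, rfl⟩
    have h1 : Finsupp.single x (1 : ℂ[X]) ∈ Finsupp.supported ℂ[X] ℂ[X] {x : Gen | n ≤ x.index} :=
      Finsupp.single_mem_supported _ _ hx
    have h2 := gen_mem_part x
    cases x
    · exact Submodule.mem_sup_left ⟨h1, h2⟩
    · exact Submodule.mem_sup_left ⟨h1, h2⟩
    · exact Submodule.mem_sup_right ⟨h1, h2⟩
  bracket_mem_right a x hx k := by
    refine bracket_coeff_mem p Set.univ {x | n ≤ x.index} _ ?_ a x (by simp) hx k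
    intro x _ y hy z hz _
    have hy' : n ≤ y.index := hy
    change n ≤ z.index
    lia
  bracket_mem_left x hx a k := by
    refine bracket_coeff_mem p {x | n ≤ x.index} Set.univ _ ?_ x a hx (by simp) k
    intro x hx y _ z hz _
    have hx' : n ≤ x.index := hx
    change n ≤ z.index
    lia

/-- The underlying `ℂ[∂]`-module of `𝒮(p)_{[n]} = 𝒮(p) / 𝒮(p)_{⟨n+1⟩}`. -/
abbrev QuotientCarrier (n : ℕ) : Type := Carrier ⧸ tail (n + 1)

/-- The quotient Lie conformal superalgebra `𝒮(p)_{[n]} = 𝒮(p) / 𝒮(p)_{⟨n+1⟩}`. -/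
def quotientAlgebra (p : ℂ) (n : ℕ) : LieConformalSuperalgebra (QuotientCarrier n) :=
  (algebra p).quotient (tail (n + 1)) (isIdeal_tail p (n + 1))

end BlockS

end

/-! Since `p ≠ 0`, the element `p⁻¹ L_0` is a Virasoro element, so `V` is a finite Virasoro module.
The bracket of `L_0` with `L_j` says that the action of `L_j` is a primary conformal map `V → V[λ]`
of weight `q = j/p + 1`. These weights are distinct, so it suffices that between two fixed finite
Virasoro modules nonzero primary maps exist for only finitely many weights
(`eventually_primaryMap_eq_zero`). Then `L_j` acts by zero for large `j`, and bracketing one such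
`L_i` with `i + p ≠ 0` against all `W_k` and `G_k` kills `W_{i+k}` and `G_{i+k}`.

For the finiteness, both modules are exhausted by stable submodules whose successive quotients are
cyclic, generated by a trivial or a primary vector (`exists_primary`); `ℂ[∂]` is Noetherian, so only
finitely many layers, hence finitely many exceptional weights, occur. On a trivial layer of the
source, a primary map vanishes by descending induction on the degree in `λ`. A primary vector of the
source is sent to a sequence of vectors in the target (`IsString`). In a trivial layer of the target
such a sequence is zero for all but two weights. In a primary layer its terms are monomials in a
shifted `∂`, and the coefficients of `λ²` and `λ³` overdetermine them unless `q` avoids none of a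
finite list of values and roots (`polynomial_string_eq_zero`). -/

noncomputable section

/-! ### Eigenvalues on finite-dimensional subspaces. -/

theorem exists_eigenvector_mem {E : Type*} [AddCommGroup E] [Module ℂ E]
    {K : Submodule ℂ E} [FiniteDimensional ℂ K] (hK : K ≠ ⊥)
    (f : E →ₗ[ℂ] E) (hf : ∀ v ∈ K, f v ∈ K) : ∃ c : ℂ, ∃ v ∈ K, v ≠ 0 ∧ f v = c • v := by
  have : Nontrivial K := Submodule.nontrivial_iff_ne_bot.2 hK
  obtain ⟨c, hc⟩ := Module.End.exists_eigenvalue (f.restrict hf)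
  obtain ⟨v, hv⟩ := hc.exists_hasEigenvector
  exact ⟨c, v, v.2, fun h => hv.2 (Subtype.ext h), congrArg Subtype.val hv.apply_eq_smul⟩

/-- An injective operator cannot shift the eigenvalues of another one in finite dimension. -/
theorem not_injective_of_shift {E : Type*} [AddCommGroup E] [Module ℂ E]
    {K : Submodule ℂ E} [FiniteDimensional ℂ K] (hK : K ≠ ⊥)
    (f g : E →ₗ[ℂ] E) (hf : ∀ v ∈ K, f v ∈ K) (hg : ∀ v ∈ K, g v ∈ K) (c : ℂ) (hc : c ≠ 0)
    (hfg : ∀ v ∈ K, f (g v) - g (f v) = c • g v) : ∃ v ∈ K, v ≠ 0 ∧ g v = 0 := by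
  by_contra! hinj
  obtain ⟨ν, v, hv, hv0, hfv⟩ := exists_eigenvector_mem hK f hf
  -- The vectors `g^k v` are nonzero eigenvectors of `f` with distinct eigenvalues `ν + k c`, too
  -- many for finite dimension.
  have h : ∀ k : ℕ, ∃ w ∈ K, w ≠ 0 ∧ f w = (ν + k * c) • w := by
    intro k
    induction k with
    | zero => exact ⟨v, hv, hv0, by simpa using hfv⟩
    | succ k ih =>
      obtain ⟨w, hw, hw0, hfw⟩ := ih
      refine ⟨g w, hg w hw, hinj w hw hw0, ?_⟩
      rw [sub_eq_iff_eq_add.1 (hfg w hw), hfw, map_smul, ← add_smul]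
      congr 1
      push_cast
      ring
  have hfin := Module.End.finite_hasEigenvalue (f.restrict hf)
  refine Set.infinite_of_injective_forall_mem (f := fun k : ℕ => ν + k * c) ?_ ?_ hfin
  · intro k k' hkk
    simpa [hc] using hkk
  · intro k
    obtain ⟨w, hw, hw0, hfw⟩ := h k
    refine Module.End.hasEigenvalue_of_hasEigenvector (x := ⟨w, hw⟩) ⟨?_, ?_⟩
    · rw [Module.End.mem_eigenspace_iff]
      exact Subtype.ext hfw
    · exact fun h => hw0 (congrArg Subtype.val h)

/-! ### Finite Virasoro modules and existence of primary vectors. -/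

section VirasoroActions

variable {W : Type*} [AddCommGroup W] [Module ℂ W] [Module ℂ[X] W] [IsScalarTower ℂ ℂ[X] W]

/-- A conformal action of the centreless Virasoro algebra on a `ℂ[∂]`-module: `op a` is `a!` times
the coefficient of `λ^a` in the action of the Virasoro element. -/
structure VirAction (W : Type*) [AddCommGroup W] [Module ℂ W] [Module ℂ[X] W]
    [IsScalarTower ℂ ℂ[X] W] where
  op : ℕ → W →ₗ[ℂ] W
  op_X_smul : ∀ a v, op a ((X : ℂ[X]) • v) = (X : ℂ[X]) • op a v + (a : ℂ) • op (a - 1) v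
  op_comm : ∀ a b v, op a (op b v) - op b (op a v) = ((a : ℂ) - b) • op (a + b - 1) v
  locallyFinite : ∀ v, ∃ N, ∀ a ≥ N, op a v = 0

theorem C_smul_eq (c : ℂ) (v : W) : (C c : ℂ[X]) • v = c • v := by
  rw [← algebraMap_eq, algebraMap_smul]

theorem X_smul_comm (c : ℂ) (v : W) : (X : ℂ[X]) • c • v = c • (X : ℂ[X]) • v :=
  smul_comm _ _ _

theorem divX_smul (f : ℂ[X]) (v : W) :
    f • v = (X : ℂ[X]) • f.divX • v + f.coeff 0 • v := by
  conv_lhs => rw [← divX_mul_X_add f]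
  rw [add_smul, mul_comm, mul_smul, C_smul_eq]

namespace VirAction

variable (D : VirAction W)

theorem op_C_smul (a : ℕ) (c : ℂ) (v : W) : D.op a ((C c : ℂ[X]) • v) = c • D.op a v := by
  rw [C_smul_eq, map_smul]

/-- The leading coefficient of `f(∂ + λ) u_λ`. -/
theorem op_smul_leading (u : W) (N : ℕ) (hu : ∀ a > N, D.op a u = 0) (n : ℕ) :
    ∀ f : ℂ[X], f.natDegree ≤ n → (∀ a > N + n, D.op a (f • u) = 0) ∧
      D.op (N + n) (f • u) = (((N + n).descFactorial n : ℂ) * f.coeff n) • D.op N u := by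
  induction n with
  | zero =>
    intro f hf
    rw [eq_C_of_natDegree_le_zero hf]
    refine ⟨fun a ha => ?_, ?_⟩
    · rw [op_C_smul, hu a ha, smul_zero]
    · simp [op_C_smul]
  | succ n ih =>
    intro f hf
    have hg : f.divX.natDegree ≤ n := by rw [natDegree_divX_eq_natDegree_tsub_one]; lia
    obtain ⟨h1, h2⟩ := ih _ hg
    refine ⟨fun a ha => ?_, ?_⟩
    · rw [divX_smul, map_add, op_X_smul, h1 a (by lia), h1 (a - 1) (by lia), map_smul,
        hu a (by lia)]
      simp
    -- Only the term `a • op (a - 1)` produced by moving past `∂` reaches the top degree; its factor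
    -- `a = N + n + 1` extends the descending factorial.
    · rw [divX_smul, map_add, op_X_smul, h1 (N + (n + 1)) (by lia),
        show N + (n + 1) - 1 = N + n by lia, h2, map_smul, hu (N + (n + 1)) (by lia), coeff_divX,
        ← add_assoc, Nat.succ_descFactorial_succ]
      simp only [smul_zero, zero_add, add_zero, smul_smul]
      congr 1
      push_cast
      ring

theorem exists_top (u : W) (hu : ∃ a, D.op a u ≠ 0) :
    ∃ N, D.op N u ≠ 0 ∧ ∀ a > N, D.op a u = 0 := by
  classical
  obtain ⟨M, hM⟩ := D.locallyFinite u
  obtain ⟨a, ha⟩ := hu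
  have haM : a ≤ M := by
    by_contra h
    exact ha (hM a (by lia))
  refine ⟨Nat.findGreatest (fun a => D.op a u ≠ 0) M,
    Nat.findGreatest_spec (P := fun a => D.op a u ≠ 0) haM ha, ?_⟩
  intro b hb
  by_contra h
  rcases le_or_gt b M with hbM | hbM
  · exact Nat.findGreatest_is_greatest hb hbM h
  · exact h (hM b hbM.le)

/-- The vectors whose image under the action has degree less than `n` in `λ`. -/
def lowDegree (n : ℕ) : Submodule ℂ W where
  carrier := {v | ∀ a ≥ n, D.op a v = 0}
  add_mem' := fun {v w} hv hw a ha => by rw [map_add, hv a ha, hw a ha, add_zero]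
  zero_mem' := fun a _ => map_zero _
  smul_mem' := fun c v hv a ha => by rw [map_smul, hv a ha, smul_zero]

/-- Multiplying by `f(∂)` multiplies `u_λ` by `f(∂ + λ)`, which raises the degree in `λ` by exactly
`deg f`. Consequences: `lowDegree n` meets the multiples of `∂ⁿ` trivially, and a vector on which
the action is nonzero generates a free module. -/
theorem smul_notMem_lowDegree {u : W} (hu : ∃ a, D.op a u ≠ 0) {f : ℂ[X]} (hf : f ≠ 0) :
    f • u ∉ D.lowDegree f.natDegree := by
  intro h
  obtain ⟨N, hN, hN'⟩ := D.exists_top u hu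
  have h1 := (D.op_smul_leading u N hN' f.natDegree f le_rfl).2
  rw [h _ (by lia)] at h1
  refine smul_ne_zero (mul_ne_zero ?_ (leadingCoeff_ne_zero.2 hf)) hN h1.symm
  exact_mod_cast (Nat.descFactorial_pos.2 (Nat.le_add_left _ _)).ne'

end VirAction

/-- A finitely generated `ℂ[∂]`-module is finite-dimensional modulo `∂ⁿ`. -/
theorem exists_finiteDimensional_add_X_pow_smul [Module.Finite ℂ[X] W] (n : ℕ) :
    ∃ F : Submodule ℂ W, FiniteDimensional ℂ F ∧
      ∀ v : W, ∃ u ∈ F, ∃ w : W, v = u + (X ^ n : ℂ[X]) • w := by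
  induction n with
  | zero => exact ⟨⊥, inferInstance, fun v => ⟨0, Submodule.zero_mem _, v, by simp⟩⟩
  | succ n ih =>
    obtain ⟨F, hF, h⟩ := ih
    obtain ⟨s, hs⟩ := (Module.Finite.fg_top : (⊤ : Submodule ℂ[X] W).FG)
    let E : Submodule ℂ W := Submodule.span ℂ (s : Set W)
    have hE : FiniteDimensional ℂ E := FiniteDimensional.span_finset ℂ s
    have key : ∀ v : W, ∃ u ∈ E, ∃ w : W, v = u + (X : ℂ[X]) • w := by
      intro v
      have hv : v ∈ Submodule.span ℂ[X] (s : Set W) := hs ▸ Submodule.mem_top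
      induction hv using Submodule.span_induction with
      | mem v hv => exact ⟨v, Submodule.subset_span hv, 0, by simp⟩
      | zero => exact ⟨0, Submodule.zero_mem _, 0, by simp⟩
      | add v v' _ _ h h' =>
        obtain ⟨u, hu, w, rfl⟩ := h
        obtain ⟨u', hu', w', rfl⟩ := h'
        exact ⟨u + u', Submodule.add_mem _ hu hu', w + w', by rw [smul_add]; abel⟩
      | smul f v _ h =>
        obtain ⟨u, hu, w, rfl⟩ := h
        refine ⟨f.coeff 0 • u, Submodule.smul_mem _ _ hu, f.divX • u + f • w, ?_⟩
        rw [smul_add, divX_smul f u, smul_add, smul_comm f]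
        abel
    refine ⟨F ⊔ E.map ((LinearMap.lsmul ℂ[X] W (X ^ n)).restrictScalars ℂ), inferInstance, ?_⟩
    intro v
    obtain ⟨u, hu, w, rfl⟩ := h v
    obtain ⟨u', hu', w', rfl⟩ := key w
    refine ⟨u + (X ^ n : ℂ[X]) • u', ?_, w', ?_⟩
    · exact Submodule.add_mem_sup hu ⟨u', hu', rfl⟩
    · rw [smul_add, smul_smul, pow_succ, add_assoc]

/-- The subspace embeds into `W / ∂ⁿW`, which is finite-dimensional because `W` is finitely
generated. -/
theorem finiteDimensional_of_disjoint_X_pow_smul [Module.Finite ℂ[X] W] (n : ℕ)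
    (K : Submodule ℂ W) (hK : ∀ w : W, (X ^ n : ℂ[X]) • w ∈ K → w = 0) :
    FiniteDimensional ℂ K := by
  obtain ⟨F, hF, h⟩ := exists_finiteDimensional_add_X_pow_smul (W := W) n
  let R : Submodule ℂ W := LinearMap.range ((LinearMap.lsmul ℂ[X] W (X ^ n)).restrictScalars ℂ)
  have hsurj : Function.Surjective (R.mkQ.comp F.subtype) := by
    intro x
    obtain ⟨v, rfl⟩ := R.mkQ_surjective x
    obtain ⟨u, hu, w, rfl⟩ := h v
    refine ⟨⟨u, hu⟩, ?_⟩
    have : R.mkQ ((X ^ n : ℂ[X]) • w) = 0 := by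
      rw [Submodule.mkQ_apply, Submodule.Quotient.mk_eq_zero]
      exact ⟨w, rfl⟩
    rw [map_add, this, add_zero]
    rfl
  have : FiniteDimensional ℂ (W ⧸ R) := Module.Finite.of_surjective _ hsurj
  refine FiniteDimensional.of_injective (R.mkQ.comp K.subtype) ?_
  rw [← LinearMap.ker_eq_bot, LinearMap.ker_eq_bot']
  rintro ⟨v, hv⟩ h0
  have : v ∈ R := by simpa using h0
  obtain ⟨w, hw⟩ := this
  have hw' : (X ^ n : ℂ[X]) • w = v := hw
  have := hK w (hw' ▸ hv)
  rw [this, smul_zero] at hw'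
  exact Subtype.ext hw'.symm

namespace VirAction

variable (D : VirAction W)

/-- `u_λ = (∂ + α + Δλ)u`. -/
structure IsPrimary (α Δ : ℂ) (u : W) : Prop where
  zero : D.op 0 u = (X : ℂ[X]) • u + α • u
  one : D.op 1 u = Δ • u
  two_le : ∀ a ≥ 2, D.op a u = 0

/-- The Virasoro element annihilates `u`. -/
def IsTrivial (u : W) : Prop := ∀ a, D.op a u = 0

/-- For `k ≥ 1` the commutator index `a + k - 1` is still at least `n`. The argument fails for `k =
0`, where `op 0 - ∂` has to replace `op 0`. -/
theorem op_mem_lowDegree {n k : ℕ} (hk : 1 ≤ k) {v : W} (hv : v ∈ D.lowDegree n) :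
    D.op k v ∈ D.lowDegree n := by
  intro a ha
  have h := D.op_comm a k v
  rw [hv a ha, map_zero, sub_zero] at h
  rw [h, hv _ (by lia), smul_zero]

/-- The spaces `lowDegree n` are finite-dimensional, so eigenvector arguments apply: an `op
1`-weight argument brings the degree in `λ` down to at most one, and a common eigenvector of `op 0 -
∂` and `op 1` is then primary. -/
theorem exists_primary [Module.Finite ℂ[X] W] [Nontrivial W]
    (hD : ∀ u, D.IsTrivial u → u = 0) : ∃ u ≠ 0, ∃ α Δ, D.IsPrimary α Δ u := by
  classical
  have hfd : ∀ n, FiniteDimensional ℂ (D.lowDegree n) := by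
    intro n
    refine finiteDimensional_of_disjoint_X_pow_smul n _ fun w hw => ?_
    by_contra hw0
    have := D.smul_notMem_lowDegree (u := w) (f := X ^ n)
      (by by_contra! h; exact hw0 (hD w h)) (pow_ne_zero _ X_ne_zero)
    rw [natDegree_X_pow] at this
    exact this hw
  have hex : ∃ n, D.lowDegree n ≠ ⊥ := by
    obtain ⟨w, hw⟩ := exists_ne (0 : W)
    obtain ⟨n, hn⟩ := D.locallyFinite w
    refine ⟨n, fun h => hw ?_⟩
    have : w ∈ D.lowDegree n := hn
    rwa [h, Submodule.mem_bot] at this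
  have h2 : D.lowDegree 2 ≠ ⊥ := by
    set n := Nat.find hex
    have hnK : D.lowDegree n ≠ ⊥ := Nat.find_spec hex
    rcases le_or_gt n 2 with hn2 | hn2
    · intro h
      refine hnK (le_bot_iff.1 (le_trans ?_ h.le))
      exact fun v hv a ha => hv a (hn2.trans ha)
    -- By minimality of `n`, `op (n - 1)` is injective on `lowDegree n`; yet it shifts the
    -- eigenvalues of `op 1` by `2 - n ≠ 0`.
    · exfalso
      obtain ⟨v, hv, hv0, hv1⟩ := not_injective_of_shift hnK (D.op 1) (D.op (n - 1))
        (fun v hv => D.op_mem_lowDegree le_rfl hv)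
        (fun v hv => D.op_mem_lowDegree (by lia) hv) ((1 : ℕ) - (n - 1 : ℕ) : ℂ)
        (by
          rw [sub_ne_zero]
          exact_mod_cast (show 1 ≠ n - 1 by lia))
        (fun v _ => by rw [D.op_comm, show 1 + (n - 1) - 1 = n - 1 by lia])
      have hmin := Nat.find_min hex (m := n - 1) (by lia)
      refine hmin fun h => hv0 ?_
      have : v ∈ D.lowDegree (n - 1) := by
        intro a ha
        rcases Nat.eq_or_lt_of_le ha with rfl | ha
        · exact hv1
        · exact hv a (by lia)
      rwa [h, Submodule.mem_bot] at this
  -- The correction by `∂` makes `T` commute with every `op a`, since `[op a, op 0]` and `[op a, ∂]`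
  -- are both `a • op (a - 1)`.
  let T : W →ₗ[ℂ] W := D.op 0 - (LinearMap.lsmul ℂ[X] W X).restrictScalars ℂ
  have hT : ∀ v, T v = D.op 0 v - (X : ℂ[X]) • v := fun v => rfl
  have hTop : ∀ a v, D.op a (T v) = T (D.op a v) := by
    intro a v
    have h := D.op_comm a 0 v
    rw [hT, hT, map_sub, op_X_smul, sub_eq_iff_eq_add.1 h]
    simp
    abel
  obtain ⟨α, v, hv, hv0, hTv⟩ := exists_eigenvector_mem h2 T
    (fun v hv a ha => by rw [hTop, hv a ha, map_zero])
  let K : Submodule ℂ W := D.lowDegree 2 ⊓ LinearMap.ker (T - α • LinearMap.id)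
  have hK : ∀ v, v ∈ K ↔ v ∈ D.lowDegree 2 ∧ T v = α • v := by
    intro v
    simp [K, sub_eq_zero]
  have hKfd : FiniteDimensional ℂ K := Submodule.finiteDimensional_inf_left _ _
  obtain ⟨Δ, u, hu, hu0, hΔ⟩ := exists_eigenvector_mem (K := K)
    (fun h => hv0 (by have := (hK v).2 ⟨hv, hTv⟩; rwa [h, Submodule.mem_bot] at this)) (D.op 1)
    (fun v hv => by
      rw [hK] at hv ⊢
      exact ⟨D.op_mem_lowDegree le_rfl hv.1, by rw [← hTop, hv.2, map_smul]⟩)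
  rw [hK] at hu
  refine ⟨u, hu0, α, Δ, ?_, hΔ, hu.1⟩
  rw [← hu.2, hT]
  abel

end VirAction

end VirasoroActions

/-! ### Strings of vectors and their polynomial form. -/

section VirasoroStrings

open Filter

variable {W : Type*} [AddCommGroup W] [Module ℂ W] [Module ℂ[X] W] [IsScalarTower ℂ ℂ[X] W]

namespace VirAction

variable (D : VirAction W)

/-- A `ℂ[∂]`-submodule that is stable under the action. -/
def IsStable (I : Submodule ℂ[X] W) : Prop := ∀ a, ∀ v ∈ I, D.op a v ∈ I

/-- The action on the quotient by a stable submodule. -/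
def quotient (I : Submodule ℂ[X] W) (hI : D.IsStable I) : VirAction (W ⧸ I) where
  op a := (Submodule.Quotient.restrictScalarsEquiv ℂ I).toLinearMap ∘ₗ
    (I.restrictScalars ℂ).mapQ (I.restrictScalars ℂ) (D.op a) (hI a) ∘ₗ
    (Submodule.Quotient.restrictScalarsEquiv ℂ I).symm.toLinearMap
  op_X_smul a v := by
    obtain ⟨v, rfl⟩ := I.mkQ_surjective v
    exact congrArg I.mkQ (D.op_X_smul a v)
  op_comm a b v := by
    obtain ⟨v, rfl⟩ := I.mkQ_surjective v
    exact congrArg I.mkQ (D.op_comm a b v)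
  locallyFinite v := by
    obtain ⟨v, rfl⟩ := I.mkQ_surjective v
    obtain ⟨N, hN⟩ := D.locallyFinite v
    exact ⟨N, fun a ha => (congrArg I.mkQ (hN a ha)).trans (map_zero _)⟩

theorem op_X_add_C_smul (a : ℕ) (α : ℂ) (v : W) :
    D.op a ((X + C α : ℂ[X]) • v) =
      (X + C α : ℂ[X]) • D.op a v + (a : ℂ) • D.op (a - 1) v := by
  rw [add_smul, map_add, op_X_smul, op_C_smul, add_smul, C_smul_eq]
  abel

theorem op_smul_of_isTrivial {u : W} (hu : D.IsTrivial u) (f : ℂ[X]) : D.IsTrivial (f • u) := by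
  induction f using Polynomial.induction_on with
  | C c => exact fun a => by rw [op_C_smul, hu, smul_zero]
  | add f g hf hg => exact fun a => by rw [add_smul, map_add, hf, hg, add_zero]
  | monomial n c h =>
    intro a
    rw [pow_succ, ← mul_assoc, mul_comm, mul_smul, op_X_smul, h, h, smul_zero, smul_zero, add_zero]

/-- The action on `f(∂ + α) u` for a primary vector `u`. -/
theorem op_comp_smul {α Δ : ℂ} {u : W} (hu : D.IsPrimary α Δ u) (g : ℂ[X]) :
    ∀ a, D.op a (g.comp (X + C α) • u) =
      (X * derivative^[a] g + C (a * Δ) * derivative^[a - 1] g).comp (X + C α) • u := by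
  induction g using Polynomial.induction_on with
  | C c =>
    intro a
    rw [C_comp, op_C_smul]
    match a with
    | 0 =>
      rw [hu.zero, ← C_smul_eq, ← C_smul_eq, ← add_smul, smul_smul]
      congr 1
      simp
    | 1 =>
      rw [hu.one, ← C_smul_eq, ← C_smul_eq, smul_smul]
      congr 1
      simp [-map_mul, ← C_mul, mul_comm]
    | a + 2 =>
      rw [hu.two_le _ (by lia), iterate_derivative_C (by lia), iterate_derivative_C (by lia)]
      simp
  | add f g hf hg =>
    intro a
    rw [add_comp, add_smul, map_add, hf, hg, ← add_smul, ← add_comp, iterate_map_add,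
      iterate_map_add]
    congr 2
    ring
  | monomial n c h =>
    intro a
    rw [show C c * X ^ (n + 1) = C c * X ^ n * X by ring]
    generalize C c * X ^ n = g at h
    rw [mul_comp, X_comp, mul_comm, mul_smul, op_X_add_C_smul, h, h, ← C_smul_eq, smul_smul,
      smul_smul, ← add_smul]
    congr 1
    match a with
    | 0 =>
      simp [-mul_eq_mul_left_iff, -mul_eq_mul_right_iff]
      ring
    | 1 =>
      rw [iterate_derivative_mul_X]
      simp
      ring
    | a + 2 =>
      rw [iterate_derivative_mul_X, show a + 2 - 1 = a + 1 by lia, iterate_derivative_mul_X]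
      simp only [add_tsub_cancel_right, add_comp, mul_comp, X_comp, C_comp, nsmul_eq_mul,
        natCast_comp, Nat.cast_add, Nat.cast_one, map_add, map_mul, map_natCast, map_one,
        Nat.cast_ofNat, map_ofNat, ofNat_comp, one_comp]
      ring

/-- The relations between the coefficients of `φ_λ u` when `u` is primary of weight `Δ` and
`φ` is a primary family of maps of weight `q`. -/
structure IsString (α Δ q : ℂ) (w : ℕ → W) : Prop where
  zero : ∀ b, D.op 0 (w b) = (X : ℂ[X]) • w b + α • w b
  one : ∀ b, D.op 1 (w b) = (Δ + q - b) • w b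
  two_le : ∀ a ≥ 2, ∀ b, D.op a (w b) = (q * a - b) • w (a + b - 1)

theorem IsString.mkQ {D : VirAction W} {α Δ q : ℂ} {w : ℕ → W} (h : D.IsString α Δ q w)
    (I : Submodule ℂ[X] W) (hI : D.IsStable I) :
    (D.quotient I hI).IsString α Δ q (fun b => I.mkQ (w b)) where
  zero b := congrArg I.mkQ (h.zero b)
  one b := congrArg I.mkQ (h.one b)
  two_le a ha b := congrArg I.mkQ (h.two_le a ha b)

end VirAction

theorem eventually_quadratic_ne_zero (a b c : ℂ) (ha : a ≠ 0) :
    ∀ᶠ q : ℂ in cofinite, a * q ^ 2 + b * q + c ≠ 0 := by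
  have h0 : (C a * X ^ 2 + C b * X + C c : ℂ[X]) ≠ 0 := by
    intro h
    have := congrArg (fun f => coeff f 2) h
    simp at this
    exact ha this
  refine (finite_setOfPred_isRoot h0).subset fun q hq => ?_
  simpa using hq

/-- The first relation is an Euler equation: each `g b` is a monomial, and degree plus `b` is the
constant `Δ + q - Δ'`. The other two are recursions with steps one and two along the resulting
scalar sequence. They are compatible with a nonzero sequence only for special `q`; `hA` and `hB` are
the eliminants that exclude it. -/
theorem polynomial_string_eq_zero {Δ Δ' q : ℂ} (h0 : q ≠ Δ' - Δ) (h1 : q ≠ Δ' - Δ + 1)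
    (h2 : q ≠ Δ' - Δ + 2)
    (hA : 2 * (1 + 2 * Δ') * (2 * q + (Δ' - Δ + 2)) -
      3 * (q + (Δ' - Δ + 2)) * (q + (Δ' - Δ + 1)) ≠ 0)
    (hB : (q + (Δ' - Δ + 3)) * (q + (Δ' - Δ + 2)) - 2 * (2 * q + (Δ' - Δ + 3)) ≠ 0)
    (g : ℕ → ℂ[X])
    (hg1 : ∀ b : ℕ, X * derivative (g b) + C Δ' * g b = C (Δ + q - b) * g b)
    (hg2 : ∀ b : ℕ, X * derivative^[2] (g b) + C (2 * Δ') * derivative (g b) =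
      C (q * 2 - b) * g (b + 1))
    (hg3 : ∀ b : ℕ, X * derivative^[3] (g b) + C (3 * Δ') * derivative^[2] (g b) =
      C (q * 3 - b) * g (b + 2)) (b : ℕ) : g b = 0 := by
  have E1 : ∀ b k, (g b).coeff k ≠ 0 → ((b + k : ℕ) : ℂ) = Δ + q - Δ' := by
    intro b k hk
    have := congrArg (fun f => coeff f k) (hg1 b)
    simp only [coeff_add, coeff_C_mul] at this
    have h' : (X * derivative (g b)).coeff k = k * (g b).coeff k := by
      cases k with
      | zero => simp
      | succ k => rw [coeff_X_mul, coeff_derivative]; push_cast; ring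
    rw [h'] at this
    have h'' : (g b).coeff k * (((b + k : ℕ) : ℂ) - (Δ + q - Δ')) = 0 := by
      push_cast
      linear_combination this
    exact sub_eq_zero.1 ((mul_eq_zero.1 h'').resolve_left hk)
  have E2 : ∀ b j : ℕ, (j + 1) * (j + 2 * Δ') * (g b).coeff (j + 1) =
      (q * 2 - b) * (g (b + 1)).coeff j := by
    intro b j
    have := congrArg (fun f => coeff f j) (hg2 b)
    simp only [coeff_add, coeff_C_mul, coeff_derivative] at this
    have h' : (X * derivative^[2] (g b)).coeff j = j * (j + 1) * (g b).coeff (j + 1) := by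
      cases j with
      | zero => simp
      | succ j =>
        simp only [coeff_X_mul, Function.iterate_succ, Function.iterate_zero, Function.comp_apply,
          id_eq, coeff_derivative]
        push_cast
        ring
    rw [h'] at this
    linear_combination this
  have E3 : ∀ b j : ℕ, (j + 1) * (j + 2) * (j + 3 * Δ') * (g b).coeff (j + 2) =
      (q * 3 - b) * (g (b + 2)).coeff j := by
    intro b j
    have := congrArg (fun f => coeff f j) (hg3 b)
    simp only [coeff_add, coeff_C_mul] at this
    have h' : (X * derivative^[3] (g b)).coeff j =
        j * (j + 1) * (j + 2) * (g b).coeff (j + 2) := by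
      cases j with
      | zero => simp
      | succ j =>
        simp only [coeff_X_mul, Function.iterate_succ, Function.iterate_zero, Function.comp_apply,
          id_eq, coeff_derivative]
        push_cast
        ring
    have h'' : (derivative^[2] (g b)).coeff j = (j + 1) * (j + 2) * (g b).coeff (j + 2) := by
      simp only [Function.iterate_succ, Function.iterate_zero, Function.comp_apply, id_eq,
        coeff_derivative]
      push_cast
      ring
    rw [h', h''] at this
    linear_combination this
  by_contra hb
  obtain ⟨k, hk⟩ : ∃ k, (g b).coeff k ≠ 0 := by
    by_contra! h
    exact hb (Polynomial.ext (by simpa using h))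
  have hN := E1 b k hk
  -- Excluding total degrees 0, 1 and 2 leaves room for the recursions that start from `g M`, `g (M
  -- + 1)` and `g (M + 2)`.
  obtain ⟨M, hM⟩ : ∃ M, b + k = M + 3 := by
    refine ⟨b + k - 3, ?_⟩
    have n0 : b + k ≠ 0 := fun h => h0 (by rw [h] at hN; push_cast at hN; linear_combination -hN)
    have n1 : b + k ≠ 1 := fun h => h1 (by rw [h] at hN; push_cast at hN; linear_combination -hN)
    have n2 : b + k ≠ 2 := fun h => h2 (by rw [h] at hN; push_cast at hN; linear_combination -hN)
    lia
  rw [hM] at hN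
  have hMq : (M : ℂ) = q - (Δ' - Δ + 3) := by push_cast at hN; linear_combination hN
  have a1 := E2 (M + 2) 0
  have a2 := E2 (M + 1) 1
  have a3 := E3 (M + 1) 0
  have a4 := E2 M 2
  have a5 := E3 M 1
  push_cast at a1 a2 a3 a4 a5
  simp only [Nat.reduceAdd, Nat.add_assoc, hMq] at a1 a2 a3 a4 a5
  -- Eliminating the coefficients of `g (M + 2)` and `g (M + 1)` from `a1`, `a2`, `a3` leaves the
  -- factor in `hA`.
  have z0 : (g (M + 3)).coeff 0 = 0 := by
    by_contra h
    refine hA ((mul_eq_zero.1 (?_ : (g (M + 3)).coeff 0 * _ = 0)).resolve_left h)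
    linear_combination (-2 * (1 + 2 * Δ')) * a3 + 6 * Δ' * a2 +
      3 * (q + (Δ' - Δ + 2)) * a1
  -- With `z0`, `a1` allows a nonzero value only if `Δ' = 0`; then eliminating from `a2`, `a4`, `a5`
  -- leaves the factor in `hB`.
  have z1 : (g (M + 2)).coeff 1 = 0 := by
    by_contra h
    have hΔ : Δ' = 0 := by
      rw [z0] at a1
      have : Δ' * (g (M + 2)).coeff 1 = 0 := by linear_combination a1 / 2
      exact (mul_eq_zero.1 this).resolve_right h
    refine hB ((mul_eq_zero.1 (?_ : (g (M + 2)).coeff 1 * _ = 0)).resolve_left h)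
    rw [hΔ] at a2 a4 a5 ⊢
    linear_combination -(q + (0 - Δ + 3)) * a2 - 2 * a4 + 2 * a5
  -- From degree two on, both recursions have right side zero by induction, and their left factors
  -- `j + 1 + 2Δ'` and `j + 3Δ'` cannot vanish together, as that would force `j + 3 = 0`.
  have key : ∀ t b, b + t = M + 3 → (g b).coeff t = 0 := by
    intro t
    induction t using Nat.strong_induction_on with
    | _ t ih =>
      intro b hbt
      match t, ih, hbt with
      | 0, _, hbt => rw [show b = M + 3 by lia]; exact z0
      | 1, _, hbt => rw [show b = M + 2 by lia]; exact z1
      | j + 2, ih, hbt =>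
        have b1 := E2 b (j + 1)
        have b2 := E3 b j
        rw [ih (j + 1) (by lia) (b + 1) (by lia), mul_zero] at b1
        rw [ih j (by lia) (b + 2) (by lia), mul_zero] at b2
        by_contra h
        have p1 : (j : ℂ) + 1 ≠ 0 := by exact_mod_cast j.succ_ne_zero
        have p2 : (j : ℂ) + 2 ≠ 0 := by exact_mod_cast (j + 1).succ_ne_zero
        have p3 : (j : ℂ) + 3 ≠ 0 := by exact_mod_cast (j + 2).succ_ne_zero
        have c1 : (j : ℂ) + 1 + 2 * Δ' = 0 := by
          have : ((j : ℂ) + 2) * (j + 1 + 2 * Δ') * (g b).coeff (j + 2) = 0 := by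
            push_cast at b1
            linear_combination b1
          simpa [h, p2] using this
        have c2 : (j : ℂ) + 3 * Δ' = 0 := by simpa [h, p1, p2] using b2
        exact p3 (by linear_combination 3 * c1 - 2 * c2)
  exact hk (key k b hM)

end VirasoroStrings

/-! ### Vanishing of strings and primary maps of general weight. -/

section VirasoroVanishing

open Filter

variable {V : Type*} [AddCommGroup V] [Module ℂ V] [Module ℂ[X] V] [IsScalarTower ℂ ℂ[X] V]
variable {W : Type*} [AddCommGroup W] [Module ℂ W] [Module ℂ[X] W] [IsScalarTower ℂ ℂ[X] W]

namespace VirAction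

theorem exists_isTrivial_or_isPrimary (D : VirAction W) [Module.Finite ℂ[X] W] [Nontrivial W] :
    ∃ u ≠ 0, D.IsTrivial u ∨ ((∀ v, D.IsTrivial v → v = 0) ∧ ∃ α Δ, D.IsPrimary α Δ u) := by
  by_cases h : ∀ v, D.IsTrivial v → v = 0
  · obtain ⟨u, hu, hP⟩ := D.exists_primary h
    exact ⟨u, hu, Or.inr ⟨h, hP⟩⟩
  · push Not at h
    obtain ⟨u, hu, hu0⟩ := h
    exact ⟨u, hu0, Or.inl hu⟩

theorem IsPrimary.op_smul_mem {D : VirAction W} {α Δ : ℂ} {u : W} (hu : D.IsPrimary α Δ u)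
    (f : ℂ[X]) (a : ℕ) : D.op a (f • u) ∈ Submodule.span ℂ[X] {u} := by
  have hf : f = (f.comp (X - C α)).comp (X + C α) := by simp [comp_assoc]
  rw [hf, D.op_comp_smul hu]
  exact Submodule.smul_mem _ _ (Submodule.mem_span_singleton_self u)

/-- The action vanishes on the span, so a nonzero `w b` forces `b = Δ + q`, and for `b ≥ 1` also `2q
= b - 1`. This leaves only the two excluded weights. -/
theorem IsString.eq_zero_of_mem_span_trivial {D : VirAction W} {α Δ q : ℂ} {w : ℕ → W}
    (hw : D.IsString α Δ q w) {u : W} (hu : D.IsTrivial u)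
    (hwu : ∀ b, w b ∈ Submodule.span ℂ[X] {u}) (h0 : q ≠ -Δ) (h1 : q ≠ Δ - 1) (b : ℕ) :
    w b = 0 := by
  have ht : ∀ a b, D.op a (w b) = 0 := by
    intro a b
    obtain ⟨f, hf⟩ := Submodule.mem_span_singleton.1 (hwu b)
    rw [← hf]
    exact D.op_smul_of_isTrivial hu f a
  by_contra hb
  have e1 := hw.one b
  rw [ht, eq_comm, smul_eq_zero] at e1
  have e1 := e1.resolve_right hb
  cases b with
  | zero => exact h0 (by push_cast at e1; linear_combination e1)
  | succ b =>
    have e2 := hw.two_le 2 le_rfl b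
    rw [ht, eq_comm, show 2 + b - 1 = b + 1 by lia, smul_eq_zero] at e2
    have e2 := e2.resolve_right hb
    exact h1 (by push_cast at e1 e2; linear_combination e2 - e1)

theorem IsString.eq_zero_of_mem_span_primary {D : VirAction W} {α Δ q : ℂ} {w : ℕ → W}
    (hw : D.IsString α Δ q w) (hD : ∀ v, D.IsTrivial v → v = 0) {α' Δ' : ℂ} {u : W} (hu0 : u ≠ 0)
    (hu : D.IsPrimary α' Δ' u)
    (hwu : ∀ b, w b ∈ Submodule.span ℂ[X] {u})
    (h0 : q ≠ Δ' - Δ) (h1 : q ≠ Δ' - Δ + 1) (h2 : q ≠ Δ' - Δ + 2)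
    (hA : 2 * (1 + 2 * Δ') * (2 * q + (Δ' - Δ + 2)) -
      3 * (q + (Δ' - Δ + 2)) * (q + (Δ' - Δ + 1)) ≠ 0)
    (hB : (q + (Δ' - Δ + 3)) * (q + (Δ' - Δ + 2)) - 2 * (2 * q + (Δ' - Δ + 3)) ≠ 0) (b : ℕ) :
    w b = 0 := by
  -- The action on `u` is nonzero, so `u` generates a free module and identities of vectors become
  -- identities of polynomials.
  have hinj : ∀ f : ℂ[X], f • u = 0 → f = 0 := by
    intro f hf
    by_contra hf0
    have := D.smul_notMem_lowDegree (u := u) (by by_contra! h; exact hu0 (hD u h)) hf0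
    rw [hf] at this
    exact this (Submodule.zero_mem _)
  have hinj' : ∀ f g : ℂ[X], f.comp (X + C α') • u = g.comp (X + C α') • u → f = g := by
    intro f g hfg
    rw [← sub_eq_zero, ← sub_smul, ← sub_comp] at hfg
    have := congrArg (fun f => f.comp (X - C α')) (hinj _ hfg)
    simpa [comp_assoc, sub_eq_zero] using this
  have hg : ∀ b, ∃ g : ℂ[X], w b = g.comp (X + C α') • u := by
    intro b
    obtain ⟨f, hf⟩ := Submodule.mem_span_singleton.1 (hwu b)
    exact ⟨f.comp (X - C α'), by simp [comp_assoc, hf]⟩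
  choose g hg using hg
  suffices hgb : g b = 0 by rw [hg, hgb, zero_comp, zero_smul]
  have hop : ∀ a b, D.op a (w b) =
      (X * derivative^[a] (g b) + C (a * Δ') * derivative^[a - 1] (g b)).comp (X + C α') • u := by
    intro a b
    rw [hg, D.op_comp_smul hu]
  have hC : ∀ (c : ℂ) b, c • w b = (C c * g b).comp (X + C α') • u := by
    intro c b
    rw [hg, mul_comp, C_comp, mul_smul, C_smul_eq]
  refine polynomial_string_eq_zero h0 h1 h2 hA hB g (fun b => ?_) (fun b => ?_) (fun b => ?_) b
  · apply hinj'
    rw [← hC, ← hw.one b, hop]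
    simp
  · apply hinj'
    have := hw.two_le 2 le_rfl b
    rw [hop, show 2 + b - 1 = b + 1 by lia, hC] at this
    simpa using this
  · apply hinj'
    have := hw.two_le 3 (by lia) b
    rw [hop, show 3 + b - 1 = b + 2 by lia, hC] at this
    simpa using this

/-- Every nonzero finite Virasoro module contains a cyclic submodule without strings of general
weight. -/
theorem exists_cyclic_without_strings (D : VirAction W) [Module.Finite ℂ[X] W] [Nontrivial W] :
    ∃ u ≠ 0, D.IsStable (Submodule.span ℂ[X] {u}) ∧ ∀ α Δ : ℂ, ∀ᶠ q in cofinite, ∀ w : ℕ → W,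
      D.IsString α Δ q w → (∀ b, w b ∈ Submodule.span ℂ[X] {u}) → ∀ b, w b = 0 := by
  have hne : ∀ c : ℂ, ∀ᶠ q in cofinite, q ≠ c := fun c => by simp
  obtain ⟨u, hu0, hu | ⟨hD, α', Δ', hu⟩⟩ := D.exists_isTrivial_or_isPrimary
  · refine ⟨u, hu0, ?_, fun α Δ => ?_⟩
    · intro a v hv
      obtain ⟨f, rfl⟩ := Submodule.mem_span_singleton.1 hv
      rw [D.op_smul_of_isTrivial hu f a]
      exact Submodule.zero_mem _
    · filter_upwards [hne (-Δ), hne (Δ - 1)] with q h0 h1 w hw hwu b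
      exact hw.eq_zero_of_mem_span_trivial hu hwu h0 h1 b
  · refine ⟨u, hu0, ?_, fun α Δ => ?_⟩
    · intro a v hv
      obtain ⟨f, rfl⟩ := Submodule.mem_span_singleton.1 hv
      exact hu.op_smul_mem f a
    · filter_upwards [hne (Δ' - Δ), hne (Δ' - Δ + 1), hne (Δ' - Δ + 2),
        -- The eliminants `hA` and `hB` expanded in powers of `q`; their leading coefficients are
        -- `-3` and `1` whatever `Δ` and `Δ'` are.
        eventually_quadratic_ne_zero (-3)
          (4 * (1 + 2 * Δ') - 3 * (Δ' - Δ + 2) - 3 * (Δ' - Δ + 1))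
          (2 * (1 + 2 * Δ') * (Δ' - Δ + 2) - 3 * (Δ' - Δ + 2) * (Δ' - Δ + 1)) (by norm_num),
        eventually_quadratic_ne_zero 1 ((Δ' - Δ + 3) + (Δ' - Δ + 2) - 4)
          ((Δ' - Δ + 3) * (Δ' - Δ + 2) - 2 * (Δ' - Δ + 3)) one_ne_zero]
        with q h0 h1 h2 hA hB w hw hwu b
      refine hw.eq_zero_of_mem_span_primary hD hu0 hu hwu h0 h1 h2 ?_ ?_ b
      · convert hA using 1
        ring
      · convert hB using 1
        ring

end VirAction

/-- Ascent to the whole of a Noetherian module. -/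
theorem submodule_top_of_ascent {R M : Type*} [Ring R] [AddCommGroup M] [Module R M]
    [IsNoetherian R M] {P : Submodule R M → Prop} (hbot : P ⊥)
    (hstep : ∀ I, P I → I ≠ ⊤ → ∃ J, P J ∧ I < J) : P ⊤ := by
  obtain ⟨I, hI, hmax⟩ := (wellFounded_gt (α := Submodule R M)).has_min {I | P I} ⟨⊥, hbot⟩
  by_cases h : I = ⊤
  · exact h ▸ hI
  · obtain ⟨J, hJ, hIJ⟩ := hstep I hI h
    exact absurd hIJ (hmax J hJ)

theorem lt_comap_mkQ {R M : Type*} [Ring R] [AddCommGroup M] [Module R M] (I : Submodule R M)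
    {u : M} (hu : I.mkQ u ≠ 0) : I < (Submodule.span R {I.mkQ u}).comap I.mkQ := by
  refine lt_of_le_of_ne ?_ fun h => hu ?_
  · intro v hv
    have : I.mkQ v = 0 := (Submodule.Quotient.mk_eq_zero I).2 hv
    rw [Submodule.mem_comap, this]
    exact Submodule.zero_mem _
  · have : u ∈ (Submodule.span R {I.mkQ u}).comap I.mkQ := Submodule.mem_span_singleton_self _
    rw [← h] at this
    simpa using this

namespace VirAction

theorem IsStable.comap_mkQ {D : VirAction W} {I : Submodule ℂ[X] W} (hI : D.IsStable I)
    {J : Submodule ℂ[X] (W ⧸ I)} (hJ : (D.quotient I hI).IsStable J) :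
    D.IsStable (J.comap I.mkQ) := fun a _ hv => hJ a _ hv

theorem isStable_bot (D : VirAction W) : D.IsStable ⊥ := by
  intro a v hv
  rw [Submodule.mem_bot] at hv
  rw [hv, map_zero]
  exact Submodule.zero_mem _

/-- Ascent in the target: modulo `I` a string falls into a cyclic submodule without strings, hence
lies in `I`. The exceptional weights depend on the layer but not on the string, so they stay finite
in number. -/
theorem eventually_string_eq_zero (D : VirAction W) [Module.Finite ℂ[X] W] (α Δ : ℂ) :
    ∀ᶠ q in cofinite, ∀ w : ℕ → W, D.IsString α Δ q w → ∀ b, w b = 0 := by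
  have key : D.IsStable ⊤ ∧ ∀ᶠ q in cofinite, ∀ w : ℕ → W, D.IsString α Δ q w →
      (∀ b, w b ∈ (⊤ : Submodule ℂ[X] W)) → ∀ b, w b = 0 := by
    refine submodule_top_of_ascent (P := fun I => D.IsStable I ∧ ∀ᶠ q in cofinite, ∀ w : ℕ → W,
      D.IsString α Δ q w → (∀ b, w b ∈ I) → ∀ b, w b = 0) ?_ ?_
    · exact ⟨D.isStable_bot, .of_forall fun q w _ h b => (Submodule.mem_bot _).1 (h b)⟩
    · rintro I ⟨hI, hq⟩ hne
      have : Nontrivial (W ⧸ I) := Submodule.Quotient.nontrivial_iff.2 hne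
      obtain ⟨u, hu0, hus, hstr⟩ := (D.quotient I hI).exists_cyclic_without_strings
      obtain ⟨u, rfl⟩ := I.mkQ_surjective u
      refine ⟨_, ⟨hI.comap_mkQ hus, ?_⟩, lt_comap_mkQ I hu0⟩
      filter_upwards [hq, hstr α Δ] with q h1 h2 w hw hwJ
      refine h1 w hw fun b => ?_
      simpa using h2 _ (hw.mkQ I hI) hwJ b
  filter_upwards [key.2] with q h w hw
  exact h w hw fun _ => Submodule.mem_top

/-- A conformal linear map `φ_λ : V → W[λ]` that is primary of weight `q` for the Virasoro actions:
`[L_λ φ_μ] = (qλ - μ) φ_{λ+μ}`, where `φ b` is `b!` times the coefficient of `λ^b`. -/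
structure IsPrimaryMap (D : VirAction V) (E : VirAction W) (q : ℂ) (φ : ℕ → V →ₗ[ℂ] W) :
    Prop where
  X_smul : ∀ b v, φ b ((X : ℂ[X]) • v) = (X : ℂ[X]) • φ b v + (b : ℂ) • φ (b - 1) v
  comm : ∀ a b v, E.op a (φ b v) - φ b (D.op a v) = (q * a - b) • φ (a + b - 1) v
  locallyFinite : ∀ v, ∃ N, ∀ b ≥ N, φ b v = 0

variable {D : VirAction V} {E : VirAction W} {q : ℂ} {φ : ℕ → V →ₗ[ℂ] W}

theorem IsPrimaryMap.apply_smul_eq_zero (h : IsPrimaryMap D E q φ) {v : V} (hv : ∀ b, φ b v = 0)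
    (f : ℂ[X]) : ∀ b, φ b (f • v) = 0 := by
  induction f using Polynomial.induction_on with
  | C c => exact fun a => by rw [C_smul_eq, map_smul, hv, smul_zero]
  | add f g hf hg => exact fun a => by rw [add_smul, map_add, hf, hg, add_zero]
  | monomial n c ih =>
    intro a
    rw [pow_succ, ← mul_assoc, mul_comm, mul_smul, h.X_smul, ih, ih, smul_zero, smul_zero, add_zero]

/-- The relation with `a = 0` reads `op 0 (φ (b + 1) v) = -(b + 1) • φ b v`, so vanishing descends
from large `b` to all `b`. -/
theorem IsPrimaryMap.eq_zero_of_op_eq_zero (h : IsPrimaryMap D E q φ) {v : V}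
    (hv : ∀ a b, φ b (D.op a v) = 0) : ∀ b, φ b v = 0 := by
  obtain ⟨N, hN⟩ := h.locallyFinite v
  have : ∀ k, ∀ b, N ≤ b + k → φ b v = 0 := by
    intro k
    induction k with
    | zero => exact fun b hb => hN b hb
    | succ k ih =>
      intro b hb
      have := h.comm 0 (b + 1) v
      rw [ih (b + 1) (by lia), hv, map_zero, sub_zero, show 0 + (b + 1) - 1 = b by lia, eq_comm,
        smul_eq_zero] at this
      refine this.resolve_left ?_
      push_cast
      rw [mul_zero, zero_sub, neg_eq_zero]
      exact_mod_cast b.succ_ne_zero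
  exact fun b => this N b (by lia)

theorem IsPrimaryMap.isString (h : IsPrimaryMap D E q φ) {α Δ : ℂ} {v : V}
    (h0 : ∀ b, φ b (D.op 0 v) = φ b ((X : ℂ[X]) • v + α • v))
    (h1 : ∀ b, φ b (D.op 1 v) = φ b (Δ • v)) (h2 : ∀ a ≥ 2, ∀ b, φ b (D.op a v) = 0) :
    E.IsString α Δ q (fun b => φ b v) where
  zero b := by
    rw [sub_eq_iff_eq_add.1 (h.comm 0 b v), h0, map_add, h.X_smul, map_smul, Nat.zero_add]
    module
  one b := by
    rw [sub_eq_iff_eq_add.1 (h.comm 1 b v), h1, map_smul, Nat.add_sub_cancel_left]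
    module
  two_le a ha b := by
    rw [sub_eq_iff_eq_add.1 (h.comm a b v), h2 a ha, add_zero]

/-- Between finite modules, primary maps of general weight vanish. -/
theorem eventually_primaryMap_eq_zero (D : VirAction V) (E : VirAction W) [Module.Finite ℂ[X] V]
    [Module.Finite ℂ[X] W] :
    ∀ᶠ q in cofinite, ∀ φ : ℕ → V →ₗ[ℂ] W, IsPrimaryMap D E q φ → ∀ b v, φ b v = 0 := by
  have key : D.IsStable ⊤ ∧ ∀ᶠ q in cofinite, ∀ φ : ℕ → V →ₗ[ℂ] W, IsPrimaryMap D E q φ →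
      ∀ v ∈ (⊤ : Submodule ℂ[X] V), ∀ b, φ b v = 0 := by
    refine submodule_top_of_ascent (P := fun I => D.IsStable I ∧ ∀ᶠ q in cofinite,
      ∀ φ : ℕ → V →ₗ[ℂ] W, IsPrimaryMap D E q φ → ∀ v ∈ I, ∀ b, φ b v = 0) ?_ ?_
    · refine ⟨D.isStable_bot, .of_forall fun q φ _ v hv b => ?_⟩
      rw [(Submodule.mem_bot _).1 hv, map_zero]
    · rintro I ⟨hI, hq⟩ hne
      have : Nontrivial (V ⧸ I) := Submodule.Quotient.nontrivial_iff.2 hne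
      obtain ⟨u, hu0, hus, hvan⟩ : ∃ u : V, I.mkQ u ≠ 0 ∧
          (D.quotient I hI).IsStable (Submodule.span ℂ[X] {I.mkQ u}) ∧
          ∀ᶠ q in cofinite, ∀ φ : ℕ → V →ₗ[ℂ] W, IsPrimaryMap D E q φ →
            (∀ v ∈ I, ∀ b, φ b v = 0) → ∀ b, φ b u = 0 := by
        obtain ⟨u, hu0, hu | ⟨-, α, Δ, hu⟩⟩ := (D.quotient I hI).exists_isTrivial_or_isPrimary
        · obtain ⟨u, rfl⟩ := I.mkQ_surjective u
          refine ⟨u, hu0, ?_, .of_forall fun q φ hφ hφI => ?_⟩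
          · intro a v hv
            obtain ⟨f, rfl⟩ := Submodule.mem_span_singleton.1 hv
            rw [op_smul_of_isTrivial _ hu f a]
            exact Submodule.zero_mem _
          · exact hφ.eq_zero_of_op_eq_zero fun a b =>
              hφI _ ((Submodule.Quotient.mk_eq_zero I).1 (hu a)) b
        · obtain ⟨u, rfl⟩ := I.mkQ_surjective u
          refine ⟨u, hu0, ?_, ?_⟩
          · intro a v hv
            obtain ⟨f, rfl⟩ := Submodule.mem_span_singleton.1 hv
            exact hu.op_smul_mem f a
          · filter_upwards [E.eventually_string_eq_zero α Δ] with q hE φ hφ hφI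
            -- As `φ` vanishes on `I`, it sees only classes modulo `I`, so a vector primary in `V ⧸
            -- I` still yields a string in `W`.
            have hcongr : ∀ x y : V, I.mkQ x = I.mkQ y → ∀ b, φ b x = φ b y := by
              intro x y hxy b
              rw [← sub_eq_zero, ← map_sub]
              exact hφI _ ((Submodule.Quotient.eq I).1 hxy) b
            exact hE _ (hφ.isString (fun b => hcongr _ _ hu.zero b)
              (fun b => hcongr _ _ hu.one b)
              fun a ha b => hφI _ ((Submodule.Quotient.mk_eq_zero I).1 (hu.two_le a ha)) b)
      refine ⟨_, ⟨hI.comap_mkQ hus, ?_⟩, lt_comap_mkQ I hu0⟩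
      filter_upwards [hq, hvan] with q h1 h2 φ hφ v hv b
      obtain ⟨f, hf⟩ := Submodule.mem_span_singleton.1 (Submodule.mem_comap.1 hv)
      have hvf : v - f • u ∈ I := by
        rw [← Submodule.Quotient.mk_eq_zero, ← Submodule.mkQ_apply, map_sub, map_smul, hf, sub_self]
      rw [← sub_add_cancel v (f • u), map_add, h1 φ hφ _ hvf,
        hφ.apply_smul_eq_zero (h2 φ hφ (h1 φ hφ)) f, add_zero]
  filter_upwards [key.2] with q h φ hφ b v
  exact h φ hφ v Submodule.mem_top b

end VirAction

end VirasoroVanishing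

/-! ### Comparing coefficients of polynomials in `λ` and `μ`. -/

section Coefficients

variable {V : Type*} [AddCommGroup V] [Module ℂ V] [Module ℂ[X] V]

/-- The coefficient of `λⁿ`. -/
def LambdaPoly.lcoeff (n : ℕ) : LambdaPoly V →ₗ[ℂ] V :=
  Finsupp.lapply n ∘ₗ (PolynomialModule.coeffLinearEquiv ℂ[X] ℂ).toLinearMap

theorem LambdaPoly.lcoeff_apply (n : ℕ) (P : LambdaPoly V) : lcoeff n P = P.coeff n := rfl

theorem LambdaPoly.exists_lcoeff_eq_zero (P : LambdaPoly V) : ∃ N, ∀ n ≥ N, lcoeff n P = 0 := by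
  refine ⟨P.coeff.support.sup id + 1, fun n hn => ?_⟩
  by_contra h
  have : n ∈ P.coeff.support := Finsupp.mem_support_iff.2 h
  have := Finset.le_sup (f := id) this
  simp only [id_eq] at this
  lia

theorem LambdaPoly.lcoeff_X_smul (n : ℕ) (P : LambdaPoly V) :
    lcoeff n ((X : ℂ[X][X]) • P) = if 1 ≤ n then lcoeff (n - 1) P else 0 := by
  rw [← monomial_one_one_eq_X, lcoeff_apply, PolynomialModule.monomial_smul_apply]
  simp [lcoeff_apply]

theorem LambdaPoly.lcoeff_C_smul (n : ℕ) (f : ℂ[X]) (P : LambdaPoly V) :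
    lcoeff n ((C f : ℂ[X][X]) • P) = f • lcoeff n P := by
  rw [← monomial_zero_left, lcoeff_apply, PolynomialModule.monomial_smul_apply]
  simp [lcoeff_apply]

variable [IsScalarTower ℂ ℂ[X] V]

theorem LambdaPoly.evalAt_eq_sum (l : ℂ) (P : LambdaPoly V) (N : ℕ)
    (hN : ∀ n ≥ N, lcoeff n P = 0) :
    evalAt l P = ∑ n ∈ Finset.range N, l ^ n • lcoeff n P := by
  rw [evalAt, PolynomialModule.eval_apply, Finsupp.sum_of_support_subset (s := Finset.range N)]
  · refine Finset.sum_congr rfl fun n _ => ?_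
    rw [← C_pow, C_smul_eq, lcoeff_apply]
  · intro n hn
    rw [Finset.mem_range]
    by_contra h
    exact Finsupp.mem_support_iff.1 hn (hN n (by lia))
  · simp

theorem evalEval_eq_zero {P : ℂ[X][X]} (h : ∀ l m : ℂ, (P.eval (C m)).eval l = 0) : P = 0 := by
  refine eq_zero_of_infinite_isRoot P (Set.Infinite.mono ?_
    (Set.infinite_range_of_injective (C_injective (R := ℂ))))
  rintro _ ⟨m, rfl⟩
  exact Polynomial.funext fun l => by simpa using h l m

theorem coeff_sum_X_add_pow (N : ℕ) (c : ℕ → ℂ) (hc : ∀ s ≥ N, c s = 0) (a b : ℕ) :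
    ((∑ s ∈ Finset.range N, C (C (c s)) * (X + C X : ℂ[X][X]) ^ s).coeff b).coeff a =
      (a + b).choose b * c (a + b) := by
  have hterm : ∀ s, ((C (C (c s)) * (X + C X : ℂ[X][X]) ^ s).coeff b).coeff a =
      if s = a + b then (a + b).choose b * c (a + b) else 0 := by
    intro s
    rw [coeff_C_mul, coeff_X_add_C_pow, coeff_C_mul, ← C_eq_natCast, coeff_mul_C, coeff_X_pow]
    split_ifs with h1 h2 h2
    · subst h2
      ring
    · rw [Nat.choose_eq_zero_of_lt (by lia)]
      simp
    · lia
    · simp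
  rw [finsetSum_coeff, finsetSum_coeff, Finset.sum_congr rfl fun s _ => hterm s,
    Finset.sum_ite_eq']
  split_ifs with h
  · rfl
  · rw [hc _ (by simpa using h), mul_zero]

/-- Comparison of coefficients in `∑ lᵃmᵇ u_{ab} = (κl - νm) ∑ (l+m)ˢ c_s`, scalar version. -/
theorem factorial_mul_coeff_eq (κ ν : ℂ) (N : ℕ) (u : ℕ → ℕ → ℂ) (c : ℕ → ℂ)
    (hu : ∀ a b, N ≤ a ∨ N ≤ b → u a b = 0) (hc : ∀ s ≥ N, c s = 0)
    (h : ∀ l m : ℂ, ∑ a ∈ Finset.range N, ∑ b ∈ Finset.range N, l ^ a * m ^ b * u a b =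
      (κ * l - ν * m) * ∑ s ∈ Finset.range N, (l + m) ^ s * c s) (a b : ℕ) :
    (a.factorial * b.factorial) * u a b =
      (κ * a - ν * b) * ((a + b - 1).factorial * c (a + b - 1)) := by
  let Q : ℂ[X][X] := ∑ s ∈ Finset.range N, C (C (c s)) * (X + C X) ^ s
  have hQ : ∀ a b, (Q.coeff b).coeff a = (a + b).choose b * c (a + b) :=
    coeff_sum_X_add_pow N c hc
  let P : ℂ[X][X] := ∑ a ∈ Finset.range N, ∑ b ∈ Finset.range N, C (C (u a b) * X ^ a) * X ^ b
  have hP : ∀ a b, (P.coeff b).coeff a = u a b := by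
    intro a b
    simp only [P, finsetSum_coeff, coeff_C_mul, coeff_X_pow, mul_ite, mul_one, mul_zero,
      Finset.sum_ite_eq, Finset.mem_range]
    by_cases hb : b < N
    · simp only [hb, if_true, coeff_C_mul, coeff_X_pow, mul_ite, mul_one, mul_zero,
        Finset.sum_ite_eq, Finset.mem_range]
      split_ifs with ha
      · rfl
      · exact (hu a b (by lia)).symm
    · simp only [hb, if_false, Finset.sum_const_zero, coeff_zero]
      exact (hu a b (by lia)).symm
  have hPQ : P = C (C κ) * (C X * Q) - C (C ν) * (X * Q) := by
    rw [← sub_eq_zero]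
    refine evalEval_eq_zero fun l m => ?_
    have h' := h l m
    rw [← sub_eq_zero] at h'
    rw [← h']
    simp only [P, Q, eval_sub, eval_mul, eval_C, eval_X, eval_finsetSum, eval_pow, eval_add]
    congr 1
    · refine Finset.sum_congr rfl fun a _ => Finset.sum_congr rfl fun b _ => ?_
      ring
    · rw [Finset.sum_congr rfl fun s _ => mul_comm (c s) _, add_comm m l]
      ring
  have hab : u a b = κ * ((C X * Q).coeff b).coeff a - ν * ((X * Q).coeff b).coeff a := by
    rw [← hP, hPQ]
    simp only [coeff_sub, coeff_C_mul]
  rw [hab, coeff_C_mul]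
  have hfac : ∀ i j : ℕ, ((i.factorial : ℂ) * j.factorial) * (i + j).choose j =
      (i + j).factorial := by
    intro i j
    rw [← Nat.add_choose_mul_factorial_mul_factorial i j]
    push_cast
    ring
  -- The truncated index `a + b - 1` is genuine except at `a = b = 0`, where both sides vanish.
  cases a with
  | zero =>
    cases b with
    | zero => simp
    | succ b =>
      rw [coeff_X_mul, coeff_X_mul_zero, hQ, show 0 + (b + 1) - 1 = b by lia, Nat.factorial_succ]
      simp
      ring
  | succ a =>
    rw [coeff_X_mul, hQ]
    cases b with
    | zero =>
      rw [coeff_X_mul_zero, Nat.factorial_succ]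
      simp
      ring
    | succ b =>
      rw [coeff_X_mul, hQ, show a + 1 + (b + 1) - 1 = a + (b + 1) by lia,
        show a + 1 + b = a + (b + 1) by lia, Nat.factorial_succ a, Nat.factorial_succ b]
      have e1 := hfac a (b + 1)
      have e2 := hfac (a + 1) b
      rw [show a + 1 + b = a + (b + 1) by lia] at e2
      rw [Nat.factorial_succ] at e1 e2
      push_cast at e1 e2 ⊢
      linear_combination (κ * (a + 1) * c (a + (b + 1))) * e1 -
        (ν * (b + 1) * c (a + (b + 1))) * e2

/-- Comparison of coefficients in `∑ lᵃmᵇ u_{ab} = (κl - νm) ∑ (l+m)ˢ c_s`. -/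
theorem factorial_smul_coeff_eq {E : Type*} [AddCommGroup E] [Module ℂ E]
    (κ ν : ℂ) (N : ℕ) (u : ℕ → ℕ → E) (c : ℕ → E)
    (hu : ∀ a b, N ≤ a ∨ N ≤ b → u a b = 0) (hc : ∀ s ≥ N, c s = 0)
    (h : ∀ l m : ℂ, ∑ a ∈ Finset.range N, ∑ b ∈ Finset.range N, (l ^ a * m ^ b) • u a b =
      (κ * l - ν * m) • ∑ s ∈ Finset.range N, (l + m) ^ s • c s) (a b : ℕ) :
    ((a.factorial * b.factorial : ℂ)) • u a b =
      (κ * a - ν * b) • (((a + b - 1).factorial : ℂ) • c (a + b - 1)) := by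
  -- Linear functionals separate points, which reduces the claim to scalars.
  rw [← sub_eq_zero, ← Module.forall_dual_apply_eq_zero_iff ℂ]
  intro f
  rw [map_sub, sub_eq_zero]
  simp only [map_smul, smul_eq_mul]
  refine factorial_mul_coeff_eq κ ν N (fun a b => f (u a b)) (fun s => f (c s)) ?_ ?_ ?_ a b
  · intro a b hab
    simp only [hu a b hab, map_zero]
  · intro s hs
    simp only [hc s hs, map_zero]
  · intro l m
    simpa only [map_sum, map_smul, smul_eq_mul] using congrArg f (h l m)

end Coefficients

/-! ### Coefficient operators of a conformal module. -/

namespace ConformalModule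

open LambdaPoly

variable {S : Type*} [AddCommGroup S] [Module ℂ S] [Module ℂ[X] S] [IsScalarTower ℂ ℂ[X] S]
  {A : LieConformalSuperalgebra S}
  {V : Type*} [AddCommGroup V] [Module ℂ V] [Module ℂ[X] V] [IsScalarTower ℂ ℂ[X] V]
  (M : ConformalModule A V)

/-- The operator `n!` times the coefficient of `λⁿ` in `a_λ`. -/
def op (a : S) (n : ℕ) : V →ₗ[ℂ] V := (n.factorial : ℂ) • (lcoeff n ∘ₗ M.act a)

theorem op_apply (a : S) (n : ℕ) (v : V) :
    M.op a n v = (n.factorial : ℂ) • lcoeff n (M.act a v) := rfl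

theorem act_eq_zero_iff (a : S) (v : V) : M.act a v = 0 ↔ ∀ n, M.op a n v = 0 := by
  constructor
  · intro h n
    rw [op_apply, h, map_zero, smul_zero]
  · intro h
    ext n
    exact (smul_eq_zero.1 (h n)).resolve_left (by exact_mod_cast n.factorial_ne_zero)

theorem op_X_smul (a : S) (n : ℕ) (v : V) :
    M.op a n ((X : ℂ[X]) • v) = (X : ℂ[X]) • M.op a n v + (n : ℂ) • M.op a (n - 1) v := by
  simp only [op_apply]
  rw [M.act_d_right, add_smul, map_add, lcoeff_C_smul, lcoeff_X_smul, smul_add, X_smul_comm]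
  congr 1
  cases n with
  | zero => simp
  | succ n =>
    rw [if_pos (by lia), Nat.add_sub_cancel, smul_smul, Nat.factorial_succ, Nat.cast_mul]

theorem op_locallyFinite (a : S) (v : V) : ∃ N, ∀ n ≥ N, M.op a n v = 0 := by
  obtain ⟨N, hN⟩ := exists_lcoeff_eq_zero (M.act a v)
  exact ⟨N, fun n hn => by rw [op_apply, hN n hn, smul_zero]⟩

theorem exists_lcoeff_lcoeff_eq_zero (a b : S) (v : V) : ∃ N, ∀ n ≥ N, ∀ i j, n ≤ i ∨ n ≤ j →
    lcoeff i (M.act a (lcoeff j (M.act b v))) = 0 := by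
  obtain ⟨N, hN⟩ := exists_lcoeff_eq_zero (M.act b v)
  choose K hK using fun j => exists_lcoeff_eq_zero (M.act a (lcoeff j (M.act b v)))
  refine ⟨N + (Finset.range N).sup K, fun n hn i j hij => ?_⟩
  rcases le_or_gt N j with hj | hj
  · rw [hN j hj, map_zero, map_zero]
  · refine hK j i ?_
    have := Finset.le_sup (f := K) (Finset.mem_range.2 hj)
    lia

theorem evalAt_act_evalAt_act (a b : S) (v : V) (l m : ℂ) (N : ℕ)
    (hb : ∀ n ≥ N, lcoeff n (M.act b v) = 0)
    (hab : ∀ i j, N ≤ i ∨ N ≤ j → lcoeff i (M.act a (lcoeff j (M.act b v))) = 0) :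
    evalAt l (M.act a (evalAt m (M.act b v))) = ∑ i ∈ Finset.range N, ∑ j ∈ Finset.range N,
      (l ^ i * m ^ j) • lcoeff i (M.act a (lcoeff j (M.act b v))) := by
  rw [evalAt_eq_sum m _ N hb, map_sum, map_sum, Finset.sum_comm]
  refine Finset.sum_congr rfl fun j _ => ?_
  rw [map_smul, LinearMap.map_smul_of_tower, evalAt_eq_sum l _ N fun i hi => hab i j (Or.inl hi),
    Finset.smul_sum]
  refine Finset.sum_congr rfl fun i _ => ?_
  rw [smul_smul, mul_comm]

/-- The coefficient form of `[a_λ b_μ] = (κλ - νμ) c_{λ+μ}`. -/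
theorem op_comm {a b c : S} {κ ν : ℂ}
    (h : ∀ (l m : ℂ) (v : V), evalAt l (M.act a (evalAt m (M.act b v))) -
      evalAt m (M.act b (evalAt l (M.act a v))) = (κ * l - ν * m) • evalAt (l + m) (M.act c v))
    (i j : ℕ) (v : V) : M.op a i (M.op b j v) - M.op b j (M.op a i v) =
      (κ * i - ν * j) • M.op c (i + j - 1) v := by
  obtain ⟨N₁, h₁⟩ := exists_lcoeff_eq_zero (M.act a v)
  obtain ⟨N₂, h₂⟩ := exists_lcoeff_eq_zero (M.act b v)
  obtain ⟨N₃, h₃⟩ := exists_lcoeff_eq_zero (M.act c v)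
  obtain ⟨N₄, h₄⟩ := M.exists_lcoeff_lcoeff_eq_zero a b v
  obtain ⟨N₅, h₅⟩ := M.exists_lcoeff_lcoeff_eq_zero b a v
  -- One bound beyond which every coefficient involved vanishes, so that all evaluations become sums
  -- over the same range.
  have hN : ∃ N, N₁ ≤ N ∧ N₂ ≤ N ∧ N₃ ≤ N ∧ N₄ ≤ N ∧ N₅ ≤ N :=
    ⟨N₁ + N₂ + N₃ + N₄ + N₅, by lia, by lia, by lia, by lia, by lia⟩
  obtain ⟨N, k₁, k₂, k₃, k₄, k₅⟩ := hN
  have key := factorial_smul_coeff_eq κ ν N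
    (fun i j => lcoeff i (M.act a (lcoeff j (M.act b v))) -
      lcoeff j (M.act b (lcoeff i (M.act a v))))
    (fun s => lcoeff s (M.act c v))
    (fun i j hij => by rw [h₄ N k₄ i j hij, h₅ N k₅ j i hij.symm, sub_zero])
    (fun s hs => h₃ s (k₃.trans hs)) ?_ i j
  · simp only [op_apply, map_smul]
    rw [← key, smul_smul, smul_smul, mul_comm (j.factorial : ℂ), ← smul_sub]
  · intro l m
    rw [← evalAt_eq_sum _ _ N fun s hs => h₃ s (k₃.trans hs), ← h,
      M.evalAt_act_evalAt_act a b v l m N (fun n hn => h₂ n (k₂.trans hn)) (h₄ N k₄),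
      M.evalAt_act_evalAt_act b a v m l N (fun n hn => h₁ n (k₁.trans hn)) (h₅ N k₅),
      Finset.sum_comm (f := fun i j => (m ^ i * l ^ j) •
        lcoeff i (M.act b (lcoeff j (M.act a v)))), ← Finset.sum_sub_distrib]
    refine Finset.sum_congr rfl fun i _ => ?_
    rw [← Finset.sum_sub_distrib]
    refine Finset.sum_congr rfl fun j _ => ?_
    rw [smul_sub, mul_comm (m ^ j)]

end ConformalModule

/-! ### Sesquilinearity in the algebra and passage to a quotient algebra. -/

namespace ConformalModule

open LambdaPoly

variable {S : Type*} [AddCommGroup S] [Module ℂ S] [Module ℂ[X] S] [IsScalarTower ℂ ℂ[X] S]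
  {A : LieConformalSuperalgebra S}
  {V : Type*} [AddCommGroup V] [Module ℂ V] [Module ℂ[X] V] [IsScalarTower ℂ ℂ[X] V]
  (M : ConformalModule A V)

theorem evalAt_act_linear_smul (t a b : ℂ) (x : S) (v : V) :
    evalAt t (M.act ((C a * X + C b) • x) v) = (b - a * t) • evalAt t (M.act x v) := by
  have hX : evalAt t ((X : ℂ[X][X]) • M.act x v) = t • evalAt t (M.act x v) := by
    rw [evalAt, PolynomialModule.eval_smul, eval_X, C_smul_eq]
  rw [add_smul, mul_smul, C_smul_eq, C_smul_eq, map_add, map_smul M.act a, map_smul M.act b,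
    LinearMap.add_apply, LinearMap.smul_apply, LinearMap.smul_apply, M.act_d_left, map_add,
    LinearMap.map_smul_of_tower, LinearMap.map_smul_of_tower, map_neg, hX]
  module

theorem act_smul_eq_zero {a : S} (ha : M.act a = 0) (f : ℂ[X]) : M.act (f • a) = 0 := by
  induction f using Polynomial.induction_on with
  | C c => rw [C_smul_eq, map_smul, ha, smul_zero]
  | add f g hf hg => rw [add_smul, map_add, hf, hg, add_zero]
  | monomial n c ih =>
    ext1 v
    rw [pow_succ, ← mul_assoc, mul_comm, mul_smul, M.act_d_left, ih, LinearMap.zero_apply,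
      smul_zero, neg_zero]

/-- A conformal module on which an ideal acts trivially is a conformal module over the quotient. -/
def ofQuotient (I : Submodule ℂ[X] S) (hI : A.IsIdeal I) (h : ∀ a ∈ I, M.act a = 0) :
    ConformalModule (A.quotient I hI) V where
  part := M.part
  isCompl_part := M.isCompl_part
  act := (I.restrictScalars ℂ).liftQ M.act (fun a ha => h a ha) ∘ₗ
    (Submodule.Quotient.restrictScalarsEquiv ℂ I).symm.toLinearMap
  act_mem := by
    rintro α β _ v ⟨a, ha, rfl⟩ hv n
    exact M.act_mem α β a v ha hv n
  act_d_left a v := by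
    obtain ⟨a, rfl⟩ := I.mkQ_surjective a
    exact M.act_d_left a v
  act_d_right a v := by
    obtain ⟨a, rfl⟩ := I.mkQ_surjective a
    exact M.act_d_right a v
  act_bracket := by
    rintro α β _ _ v ⟨a, ha, rfl⟩ ⟨b, hb, rfl⟩ l m
    have hq : (A.quotient I hI).bracket (I.mkQ a) (I.mkQ b) = LambdaPoly.mk I (A.bracket a b) :=
      hI.bracket_mk a b
    rw [hq, evalAt_mk]
    exact M.act_bracket α β a b v ha hb l m

theorem ofQuotient_act_mkQ (I : Submodule ℂ[X] S) (hI : A.IsIdeal I)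
    (h : ∀ a ∈ I, M.act a = 0) (a : S) (v : V) :
    (M.ofQuotient I hI h).act (I.mkQ a) v = M.act a v := rfl

end ConformalModule

/-! ### Finite modules over `𝒮(p)`. -/

namespace BlockS

open LambdaPoly

variable {p : ℂ} {V : Type*} [AddCommGroup V] [Module ℂ V] [Module ℂ[X] V]
  [IsScalarTower ℂ ℂ[X] V] (M : ConformalModule (algebra p) V)

/-- At `λ + μ` the operator `∂` on the algebra becomes `-(λ + μ)`, so `(i + p)∂ + sλ` turns into `(s
- (i + p))λ - (i + p)μ`. -/
theorem op_L_comm (i : ℕ) (y : Gen) (s : ℂ) (z : Carrier)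
    (h : genBracket p (.L i) y = lin (i + p) s z) (a b : ℕ) (v : V) :
    M.op (L i) a (M.op (gen y) b v) - M.op (gen y) b (M.op (L i) a v) =
      ((s - (i + p)) * a - (i + p) * b) • M.op z (a + b - 1) v := by
  refine M.op_comm (fun l m v => ?_) a b v
  have h1 := M.act_bracket 0 y.parity (L i) (gen y) v (gen_mem_part (.L i)) (gen_mem_part y) l m
  have h2 : (algebra p).bracket (L i) (gen y) = genBracket p (.L i) y := bracket_gen p (.L i) y
  have h3 : paritySign 0 y.parity = 1 := by simp [paritySign]
  rw [h2, h, evalAt_lin, M.evalAt_act_linear_smul, h3, one_smul] at h1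
  rw [h1]
  congr 1
  ring

/-- The Virasoro action of `p⁻¹ L_0`. -/
def virAction (hp : p ≠ 0) : VirAction V where
  op n := p⁻¹ • M.op (L 0) n
  op_X_smul n v := by
    simp only [LinearMap.smul_apply]
    rw [M.op_X_smul, smul_add, X_smul_comm, smul_comm p⁻¹ (n : ℂ)]
  op_comm a b v := by
    have h := op_L_comm M 0 (.L 0) _ _ rfl a b v
    rw [Nat.add_zero] at h
    change M.op (L 0) a (M.op (L 0) b v) - M.op (L 0) b (M.op (L 0) a v) = _ at h
    simp only [LinearMap.smul_apply, map_smul, ← smul_sub, h, smul_smul]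
    congr 1
    push_cast
    field_simp
    ring
  locallyFinite v := by
    obtain ⟨N, hN⟩ := M.op_locallyFinite (L 0) v
    exact ⟨N, fun a ha => by rw [LinearMap.smul_apply, hN a ha, smul_zero]⟩

theorem isPrimaryMap_op_L (hp : p ≠ 0) (j : ℕ) :
    VirAction.IsPrimaryMap (virAction M hp) (virAction M hp) (p⁻¹ * j + 1) (M.op (L j)) where
  X_smul := M.op_X_smul (L j)
  comm a b v := by
    have h := op_L_comm M 0 (.L j) _ _ rfl a b v
    rw [Nat.zero_add] at h
    change M.op (L 0) a (M.op (L j) b v) - M.op (L j) b (M.op (L 0) a v) = _ at h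
    simp only [virAction, LinearMap.smul_apply, map_smul, ← smul_sub, h, smul_smul]
    congr 1
    push_cast
    field_simp
    ring
  locallyFinite := M.op_locallyFinite (L j)

/-- The weights `j/p + 1` are distinct, so only finitely many `j` meet the finite exceptional set.
-/
theorem eventually_act_L_eq_zero (hp : p ≠ 0) [Module.Finite ℂ[X] V] :
    ∃ N, ∀ j ≥ N, M.act (L j) = 0 := by
  have hinj : Function.Injective fun j : ℕ => p⁻¹ * (j : ℂ) + 1 := by
    intro j k hjk
    simpa [hp] using hjk
  have h := hinj.tendsto_cofinite.eventually
    (VirAction.eventually_primaryMap_eq_zero (virAction M hp) (virAction M hp))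
  rw [Nat.cofinite_eq_atTop, Filter.eventually_atTop] at h
  obtain ⟨N, hN⟩ := h
  refine ⟨N, fun j hj => LinearMap.ext fun v => ?_⟩
  exact (M.act_eq_zero_iff _ _).2 fun n => hN j hj _ (isPrimaryMap_op_L M hp j) n v

theorem act_eq_zero_of_bracket_L {i : ℕ} (hi : (i : ℂ) + p ≠ 0) (hL : M.act (L i) = 0) (y : Gen)
    (s : ℂ) (z : Carrier) (h : genBracket p (.L i) y = lin (i + p) s z) : M.act z = 0 := by
  ext1 v
  rw [LinearMap.zero_apply, M.act_eq_zero_iff]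
  intro n
  have hop : ∀ a v, M.op (L i) a v = 0 := by
    intro a v
    rw [M.op_apply, hL, LinearMap.zero_apply, map_zero, smul_zero]
  -- Taking `a = 0` removes `s` and isolates the factor `-(i + p)(n + 1)`, which is nonzero.
  have := op_L_comm M i y s z h 0 (n + 1) v
  rw [hop, hop, map_zero, sub_zero, show 0 + (n + 1) - 1 = n by lia, eq_comm, smul_eq_zero] at this
  refine this.resolve_left ?_
  push_cast
  rw [mul_zero, zero_sub, neg_eq_zero]
  exact mul_ne_zero hi (by exact_mod_cast n.succ_ne_zero)

theorem eventually_act_gen_eq_zero (hp : p ≠ 0) [Module.Finite ℂ[X] V] :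
    ∃ N, ∀ x : Gen, N ≤ x.index → M.act (gen x) = 0 := by
  obtain ⟨N, hN⟩ := eventually_act_L_eq_zero M hp
  -- At most one index satisfies `i + p = 0`, so `N` or `N + 1` will do.
  obtain ⟨i, hiN, hi⟩ : ∃ i ≥ N, (i : ℂ) + p ≠ 0 := by
    by_contra! h
    have h1 := h N le_rfl
    have h2 := h (N + 1) (by lia)
    push_cast at h2
    exact one_ne_zero (α := ℂ) (by linear_combination h2 - h1)
  refine ⟨i, fun x hx => ?_⟩
  obtain ⟨k, hk⟩ := Nat.exists_eq_add_of_le hx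
  cases x with
  | L j => exact hN j (hiN.trans hx)
  | W j =>
    change j = i + k at hk
    subst hk
    exact act_eq_zero_of_bracket_L M hi (hN i hiN) (.W k) _ _ rfl
  | G j =>
    change j = i + k at hk
    subst hk
    exact act_eq_zero_of_bracket_L M hi (hN i hiN) (.G k) _ _ rfl

theorem act_eq_zero_of_mem_tail {n : ℕ} (h : ∀ x : Gen, n ≤ x.index → M.act (gen x) = 0)
    (a : Carrier) (ha : a ∈ tail n) : M.act a = 0 := by
  rw [tail, Finsupp.supported_eq_span_single] at ha
  induction ha using Submodule.span_induction with
  | mem _ hx => obtain ⟨x, hx, rfl⟩ := hx; exact h x hx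
  | zero => exact map_zero _
  | add a b _ _ ha hb => rw [map_add, ha, hb, add_zero]
  | smul f a _ ha => exact M.act_smul_eq_zero ha f

theorem finite_setOf_index_lt (n : ℕ) : {x : Gen | x.index < n}.Finite := by
  refine (((Set.finite_Iio n).image Gen.L).union (((Set.finite_Iio n).image Gen.W).union
    ((Set.finite_Iio n).image Gen.G))).subset ?_
  rintro (i | i | i) hi
  · exact Or.inl ⟨i, hi, rfl⟩
  · exact Or.inr (Or.inl ⟨i, hi, rfl⟩)
  · exact Or.inr (Or.inr ⟨i, hi, rfl⟩)

theorem finite_quotientCarrier (n : ℕ) : Module.Finite ℂ[X] (QuotientCarrier n) := by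
  refine ⟨Submodule.fg_def.2 ⟨(fun x => (tail (n + 1)).mkQ (gen x)) '' {x | x.index < n + 1},
    (finite_setOf_index_lt _).image _, ?_⟩⟩
  rw [eq_top_iff]
  rintro a -
  obtain ⟨a, rfl⟩ := (tail (n + 1)).mkQ_surjective a
  refine carrier_induction (P := fun a => (tail (n + 1)).mkQ a ∈ Submodule.span ℂ[X] _) a
    (fun x => ?_) ?_ (fun a b ha hb => ?_) (fun f a ha => ?_)
  · rcases Nat.lt_or_ge x.index (n + 1) with hx | hx
    · exact Submodule.subset_span ⟨x, hx, rfl⟩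
    · have h0 : (tail (n + 1)).mkQ (gen x) = 0 :=
        (Submodule.Quotient.mk_eq_zero _).2 (Finsupp.single_mem_supported _ _ hx)
      rw [h0]
      exact Submodule.zero_mem _
  · rw [map_zero]
    exact Submodule.zero_mem _
  · rw [map_add]
    exact Submodule.add_mem _ ha hb
  · rw [map_smul]
    exact Submodule.smul_mem _ _ ha

end BlockS

end

theorem mainTheorem5 (p : ℂ) (hp : p ≠ 0) {V : Type*} [AddCommGroup V] [Module ℂ V]
    [Module ℂ[X] V] [IsScalarTower ℂ ℂ[X] V] (hfin : Module.Finite ℂ[X] V)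
    (M : ConformalModule (BlockS.algebra p) V) (hM : M.Nontrivial) :
    (∃ N : ℕ, ∀ i ≥ N, ∀ v : V,
      M.act (BlockS.L i) v = 0 ∧ M.act (BlockS.W i) v = 0 ∧ M.act (BlockS.G i) v = 0) ∧
    (∃ N : ℕ, ∀ n ≥ N,
      Module.Finite ℂ[X] (BlockS.QuotientCarrier n) ∧
      ∃ M' : ConformalModule (BlockS.quotientAlgebra p n) V,
        M'.part = M.part ∧
        ∀ (a : BlockS.Carrier) (v : V),
          M'.act ((BlockS.tail (n + 1)).mkQ a) v = M.act a v) := by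
  obtain ⟨N, hN⟩ := BlockS.eventually_act_gen_eq_zero M hp
  refine ⟨⟨N, fun i hi v => ⟨?_, ?_, ?_⟩⟩, N, fun n hn => ⟨BlockS.finite_quotientCarrier n, ?_⟩⟩
  · exact LinearMap.congr_fun (hN (.L i) hi) v
  · exact LinearMap.congr_fun (hN (.W i) hi) v
  · exact LinearMap.congr_fun (hN (.G i) hi) v
  · have h : ∀ a ∈ BlockS.tail (n + 1), M.act a = 0 :=
      BlockS.act_eq_zero_of_mem_tail M fun x hx => hN x (by lia)
    exact ⟨M.ofQuotient _ (BlockS.isIdeal_tail p (n + 1)) h, rfl, M.ofQuotient_act_mkQ _ _ h⟩
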